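/- **Notation on a triangle.** Let $x_0\in\mathbb R^3$ and let $F\subset\mathbb R^3$ be a nondegenerate triangle with $x_0\notin F$, with an arbitrary numbering $p_1,p_2,p_3$ of its vertices. Put $\gamma_1=\|p_3-p_2\|$, $\gamma_2=\|p_1-p_3\|$, $\gamma_3=\|p_2-p_1\|$, $s_1=\frac{p_3-p_2}{\gamma_1}$, $s_2=\frac{p_1-p_3}{\gamma_2}$, $s_3=\frac{p_2-p_1}{\gamma_3}$; $u=s_3$, $w=\frac{s_1\times s_2}{\|s_1\times s_2\|}$, $v=w\times u$, $m_i=s_i\times w$; $u_3=\langle u,p_3-p_1\rangle$, $v_3=\langle v,p_3-p_1\rangle$, $u_0=\langle u,x_0-p_1\rangle$, $v_0=\langle v,x_0-p_1\rangle$, $w_0=-\langle w,x_0-p_1\rangle$; $$t_1=\frac{v_0(u_3-\gamma_3)+v_3(\gamma_3-u_0)}{\gamma_1},\quad t_2=\frac{u_0v_3-v_0u_3}{\gamma_2},\quad t_3=v_0;$$ $$\gamma_1^-=-\frac{(\gamma_3-u_0)(\gamma_3-u_3)+v_0v_3}{\gamma_1},\quad \gamma_1^+=\frac{(u_3-u_0)(u_3-\gamma_3)+v_3(v_3-v_0)}{\gamma_1},$$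 $$\gamma_2^-=-\frac{u_3(u_3-u_0)+v_3(v_3-v_0)}{\gamma_2},\quad \gamma_2^+=\frac{u_0u_3+v_0v_3}{\gamma_2},\quad \gamma_3^-=-u_0,\quad \gamma_3^+=\gamma_3-u_0.$$ For $i=1,2,3$ put $R_i=\sqrt{t_i^2+w_0^2}$, $R_i^\pm=\sqrt{t_i^2+w_0^2+(\gamma_i^\pm)^2}$, $$f_i=\begin{cases}\ln\dfrac{R_i^++\gamma_i^+}{R_i^-+\gamma_i^-}&\text{if }\gamma_i^-\ge0,\\[2ex]\ln\dfrac{R_i^--\gamma_i^-}{R_i^+-\gamma_i^+}&\text{if }\gamma_i^-<0,\end{cases}\qquad \beta_i=\arctan\frac{t_i\gamma_i^+}{R_i^2+|w_0|R_i^+}-\arctan\frac{t_i\gamma_i^-}{R_i^2+|w_0|R_i^-},$$ $\beta=\beta_1+\beta_2+\beta_3$, where a quotient $0/0$ in $\beta_i$ is read as $0$ (this can occur only if $w_0=0$, when $\beta$ does not contribute below). Put $$a=\begin{pmatrix}-1/\gamma_3\\1/\gamma_3\\0\end{pmatrix},\quad b=\begin{pmatrix}(u_3/\gamma_3-1)/v_3\\-u_3/(\gamma_3v_3)\\1/v_3\end{pmatrix},\quad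 \varphi(u_0,v_0)=\begin{pmatrix}1\\0\\0\end{pmatrix}+u_0a+v_0b,$$ $$M_0=\operatorname{sign}(w_0)\,\beta\,w-\sum_{i=1}^3f_im_i,$$ $$M_u=\sum_{i=1}^3\langle u,s_i\rangle\bigl(f_it_is_i-(R_i^+-R_i^-)m_i\bigr)-|w_0|\beta u-\Bigl(\sum_{i=1}^3\langle u,m_i\rangle f_i\Bigr)w_0w,$$ $$M_v=\sum_{i=1}^3\langle v,s_i\rangle\bigl(f_it_is_i-(R_i^+-R_i^-)m_i\bigr)-|w_0|\beta v-\Bigl(\sum_{i=1}^3\langle v,m_i\rangle f_i\Bigr)w_0w,$$ with $\operatorname{sign}(0)=0$. For a function $\chi$ with values $c(F)=(\chi(p_1),\chi(p_2),\chi(p_3))^T$ at the vertices, put $$I(F)=(M_0,M_u,M_v)\begin{pmatrix}\langle\varphi(u_0,v_0),c(F)\rangle\\\langle a,c(F)\rangle\\\langle b,c(F)\rangle\end{pmatrix}\in\mathbb R^3.$$ **Lemma.** Let $K\subset\mathbb R^3$ be a nondegenerate closed tetrahedron with vertices $P_1,\dots,P_4$ and let $x_0\in\mathbb R^3\setminus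 K$, $M\in\mathbb R^3$. Let $\sigma\in\mathbb R^{3\times3}$ be symmetric (the constant conductivity tensor on $K$), $\sigma^\infty>0$, and $$u^\infty(x)=\frac{1}{4\pi\sigma^\infty}\,\frac{\langle M,x-x_0\rangle}{\|x-x_0\|^3}.$$ Let $\chi$ be affine on $K$, and let $\varphi_1,\dots,\varphi_4$ be the nodal Lagrange basis functions on $K$, i.e. $\varphi_i$ is affine on $K$ with $\varphi_i(P_j)=\delta_{ij}$. Let $\mu_K$ be the affine map from the reference tetrahedron with vertices $0,e_1,e_2,e_3$ onto $K$ that sends these vertices to $P_1,P_2,P_3,P_4$ in this order, let $A\in\mathbb R^{3\times3}$ be its Jacobian, and let $G=(\nabla\widehat\varphi_1,\dots,\nabla\widehat\varphi_4)\in\mathbb R^{3\times4}$, where $\widehat\varphi_1=1-x_1-x_2-x_3$ and $\widehat\varphi_{k+1}=x_k$ for $k=1,2,3$ are the shape functions on the reference tetrahedron. Let $F_1,\dots,F_4$ be the faces of $K$, each with an arbitrary numbering of its vertices, and let $\eta(F_j)$ be the unit outer normal of $K$ on $F_j$. Then the functions $\langle\sigma\nabla(\chi u^\infty),\nabla\varphi_i\rangle$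 are integrable on $K$ and $$\left(\int_K\langle\sigma\nabla(\chi u^\infty),\nabla\varphi_i\rangle\,dV\right)_{i=1}^4=\frac{(\sigma A^{-T}G)^T}{4\pi\sigma^\infty}\sum_{j=1}^4\langle I(F_j),M\rangle\,\eta(F_j).$$ -/

import Mathlib

open scoped RealInnerProductSpace Gradient

noncomputable section

/-- Euclidean three-space. -/
abbrev E3 : Type := EuclideanSpace ℝ (Fin 3)

/-- The matrix-vector product on Euclidean space. -/
def matVec (S : Matrix (Fin 3) (Fin 3) ℝ) (x : E3) : E3 :=
  WithLp.toLp 2 (S.mulVec x.ofLp)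

/-- The cross product on Euclidean space. -/
def cross (x y : E3) : E3 :=
  WithLp.toLp 2 (crossProduct x.ofLp y.ofLp)

/-- The potential of a point dipole at `x₀` with moment `M` in an unbounded homogeneous conductor
with isotropic conductivity `σinf`. -/
def uInf (σinf : ℝ) (x₀ M : E3) (x : E3) : ℝ :=
  ⟪M, x - x₀⟫ / (4 * Real.pi * σinf * ‖x - x₀‖ ^ 3)

/-- `f` agrees on `K` with an affine function. -/
def IsAffineOn (f : E3 → ℝ) (K : Set E3) : Prop :=
  ∃ g : E3 →ᵃ[ℝ] ℝ, Set.EqOn f g K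

/-- The (closed) tetrahedron with vertices `P 0, P 1, P 2, P 3`. -/
def tetrahedron (P : Fin 4 → E3) : Set E3 := convexHull ℝ (Set.range P)

/-- `φ 0, …, φ 3` are the nodal (first order) Lagrange basis functions on the tetrahedron with
vertices `P`. Nothing is said about their values outside the tetrahedron. -/
def IsNodalBasis (P : Fin 4 → E3) (φ : Fin 4 → E3 → ℝ) : Prop :=
  ∀ i, IsAffineOn (φ i) (tetrahedron P) ∧ ∀ j, φ i (P j) = if i = j then 1 else 0

/-- `η` is the unit outer normal of the convex body `K` on its flat face `F`. -/
def IsUnitOuterNormal (K F : Set E3) (η : E3) : Prop :=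
  ‖η‖ = 1 ∧ (∀ x ∈ F, ∀ y ∈ F, ⟪η, x - y⟫ = 0) ∧ ∀ x ∈ K, ∀ y ∈ F, ⟪η, x - y⟫ ≤ 0

/-! ### The reference tetrahedron -/

/-- The vertices `0, e₁, e₂, e₃` of the reference tetrahedron. -/
def refVertex : Fin 4 → E3 :=
  ![0, EuclideanSpace.single 0 1, EuclideanSpace.single 1 1, EuclideanSpace.single 2 1]

/-- The shape functions on the reference tetrahedron. -/
def shapeFun (i : Fin 4) (x : E3) : ℝ :=
  ![1 - x 0 - x 1 - x 2, x 0, x 1, x 2] i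

/-- The matrix whose columns are the (constant) gradients of the shape functions. -/
def shapeGrad : Matrix (Fin 3) (Fin 4) ℝ :=
  Matrix.of fun k i => (∇ (shapeFun i) 0) k

/-- The (constant) Jacobian matrix of an affine map. -/
def affineJacobian (μ : E3 →ᵃ[ℝ] E3) : Matrix (Fin 3) (Fin 3) ℝ :=
  Matrix.of fun k l => (fderiv ℝ μ 0 (EuclideanSpace.single l 1)) k

/-! ### Quantities attached to a triangle

A triangle is given by a numbering `p 0, p 1, p 2` of its vertices; the indices `0, 1, 2` stand
for `1, 2, 3`. Index arithmetic in `Fin 3` is cyclic. -/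

namespace Tri

variable (p : Fin 3 → E3) (x₀ : E3)

/-- The edge lengths. -/
def γ (i : Fin 3) : ℝ := ‖p (i + 2) - p (i + 1)‖

/-- The unit edge vectors. -/
def s (i : Fin 3) : E3 := (γ p i)⁻¹ • (p (i + 2) - p (i + 1))

def u : E3 := s p 2

def w : E3 := ‖cross (s p 0) (s p 1)‖⁻¹ • cross (s p 0) (s p 1)

def v : E3 := cross (w p) (u p)

/-- The in-plane edge normals. -/
def m (i : Fin 3) : E3 := cross (s p i) (w p)

def u3 : ℝ := ⟪u p, p 2 - p 0⟫

def v3 : ℝ := ⟪v p, p 2 - p 0⟫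

def u0 : ℝ := ⟪u p, x₀ - p 0⟫

def v0 : ℝ := ⟪v p, x₀ - p 0⟫

def w0 : ℝ := -⟪w p, x₀ - p 0⟫

def t : Fin 3 → ℝ :=
  ![(v0 p x₀ * (u3 p - γ p 2) + v3 p * (γ p 2 - u0 p x₀)) / γ p 0,
    (u0 p x₀ * v3 p - v0 p x₀ * u3 p) / γ p 1,
    v0 p x₀]

def γminus : Fin 3 → ℝ :=
  ![-(((γ p 2 - u0 p x₀) * (γ p 2 - u3 p) + v0 p x₀ * v3 p) / γ p 0),
    -((u3 p * (u3 p - u0 p x₀) + v3 p * (v3 p - v0 p x₀)) / γ p 1),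
    -u0 p x₀]

def γplus : Fin 3 → ℝ :=
  ![((u3 p - u0 p x₀) * (u3 p - γ p 2) + v3 p * (v3 p - v0 p x₀)) / γ p 0,
    (u0 p x₀ * u3 p + v0 p x₀ * v3 p) / γ p 1,
    γ p 2 - u0 p x₀]

def R (i : Fin 3) : ℝ := Real.sqrt (t p x₀ i ^ 2 + w0 p x₀ ^ 2)

def Rplus (i : Fin 3) : ℝ := Real.sqrt (t p x₀ i ^ 2 + w0 p x₀ ^ 2 + γplus p x₀ i ^ 2)

def Rminus (i : Fin 3) : ℝ := Real.sqrt (t p x₀ i ^ 2 + w0 p x₀ ^ 2 + γminus p x₀ i ^ 2)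

def f (i : Fin 3) : ℝ :=
  if 0 ≤ γminus p x₀ i then
    Real.log ((Rplus p x₀ i + γplus p x₀ i) / (Rminus p x₀ i + γminus p x₀ i))
  else
    Real.log ((Rminus p x₀ i - γminus p x₀ i) / (Rplus p x₀ i - γplus p x₀ i))

/-- If the denominators vanish, so do the numerators, and the quotients are read as `0`. In that
case `w0 = 0`, and `β` is only used multiplied by `sign w0` or `|w0|`. -/
def βi (i : Fin 3) : ℝ :=
  Real.arctan (t p x₀ i * γplus p x₀ i / (R p x₀ i ^ 2 + |w0 p x₀| * Rplus p x₀ i))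
    - Real.arctan (t p x₀ i * γminus p x₀ i / (R p x₀ i ^ 2 + |w0 p x₀| * Rminus p x₀ i))

def β : ℝ := ∑ i, βi p x₀ i

def a : Fin 3 → ℝ := ![-(1 / γ p 2), 1 / γ p 2, 0]

def b : Fin 3 → ℝ := ![(u3 p / γ p 2 - 1) / v3 p, -(u3 p / (γ p 2 * v3 p)), 1 / v3 p]

/-- The vector `φ(u₀, v₀) = e₁ + u₀ a + v₀ b`. -/
def φ₀ : Fin 3 → ℝ := ![1, 0, 0] + u0 p x₀ • a p + v0 p x₀ • b p

def M0 : E3 :=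
  (Real.sign (w0 p x₀) * β p x₀) • w p - ∑ i, f p x₀ i • m p i

def Mu : E3 :=
  ∑ i, ⟪u p, s p i⟫ •
      ((f p x₀ i * t p x₀ i) • s p i - (Rplus p x₀ i - Rminus p x₀ i) • m p i)
    - (|w0 p x₀| * β p x₀) • u p
    - ((∑ i, ⟪u p, m p i⟫ * f p x₀ i) * w0 p x₀) • w p

def Mv : E3 :=
  ∑ i, ⟪v p, s p i⟫ •
      ((f p x₀ i * t p x₀ i) • s p i - (Rplus p x₀ i - Rminus p x₀ i) • m p i)
    - (|w0 p x₀| * β p x₀) • v p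
    - ((∑ i, ⟪v p, m p i⟫ * f p x₀ i) * w0 p x₀) • w p

/-- The matrix with columns `M0, Mu, Mv`. -/
def MMat : Matrix (Fin 3) (Fin 3) ℝ :=
  Matrix.of fun k l => ![M0 p x₀, Mu p x₀, Mv p x₀] l k

/-- The vector `I(F)` for the nodal values `c` of `χ` at the vertices `p`. -/
def I (c : Fin 3 → ℝ) : E3 :=
  matVec (MMat p x₀) (WithLp.toLp 2 ![φ₀ p x₀ ⬝ᵥ c, a p ⬝ᵥ c, b p ⬝ᵥ c])

end Tri

end

/-! The gradient of a nodal basis function is constant, namely a column of `A^{-T} G`. Since `σ` is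
symmetric, the integrand is therefore the derivative of `χ u^∞` in the constant direction `σ ∇φ_i`.
As `x₀ ∉ K`, the product is smooth near `K` once `χ` is replaced by its affine extension. The
gradient theorem on the tetrahedron, `setIntegral_fderiv_tetrahedron`, then reduces everything to
integrals of `χ u^∞` over the four faces, and `Tri.inner_I_eq_faceInt` evaluates these as `⟪I(F), M⟫
/ (4πσ^∞)`.

On a face put `y = x - x₀` and `r = ‖y‖`. There `χ` is a combination of `1`, `⟪u, y⟫` and `⟪v, y⟫`,
while `⟪w, y⟫ = w0` is constant. Splitting `M` into a tangential and a normal part leaves the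
integrals of `r⁻³`, `⟪d, y⟫ r⁻³` and `⟪e, y⟫ ⟪d, y⟫ r⁻³` with `d`, `e` tangential. The gradient
theorem on the triangle, `Tri.faceInt_fderiv`, moves them to the edges by means of `∂_d r⁻¹ = -⟪d,
y⟫ r⁻³`, `∂_d (⟪e, y⟫ r⁻¹) = ⟪e, d⟫ r⁻¹ - ⟪e, y⟫ ⟪d, y⟫ r⁻³`, `div (y_tan / (r (r + |w0|))) = |w0|
r⁻³`, where `y_tan` is the tangential part of `y`. The extra integral of `r⁻¹` in the second
identity is found by taking its trace over `u` and `v`.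

On edge `i`, with `l` the signed arc length from the foot of the perpendicular from `x₀`, one has `r
= √(t_i² + w0² + l²)`. The edge integrals then have elementary primitives: a logarithm gives `f`,
`r` itself gives `Rplus - Rminus`, and an arctangent gives `βi`. The arctangent is needed only for
`w0 ≠ 0`, because the integral of `r⁻³` always enters with a factor `w0`. -/

/-! ### Gradient theorem on triangles and tetrahedra in affine coordinates. -/

section Analysis

open MeasureTheory Set

/-- The standard triangle. -/
def stdTri : Set (ℝ × ℝ) := {q | 0 ≤ q.1 ∧ 0 ≤ q.2 ∧ q.1 + q.2 ≤ 1}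

/-- The standard tetrahedron, as a subset of `ℝ × ℝ × ℝ`. -/
def stdTet : Set (ℝ × ℝ × ℝ) := {z | 0 ≤ z.1 ∧ z.2 ∈ stdTri ∧ z.1 + (z.2.1 + z.2.2) ≤ 1}

theorem isClosed_stdTri : IsClosed stdTri :=
  (isClosed_le continuous_const continuous_fst).inter
    ((isClosed_le continuous_const continuous_snd).inter
      (isClosed_le (continuous_fst.add continuous_snd) continuous_const))

theorem isCompact_stdTri : IsCompact stdTri := by
  refine (isCompact_Icc (a := ((0 : ℝ), (0 : ℝ))) (b := (1, 1))).of_isClosed_subset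
    isClosed_stdTri ?_
  rintro ⟨s, t⟩ ⟨h1, h2, h3⟩
  simp only at h1 h2 h3
  exact ⟨⟨h1, h2⟩, ⟨by simp only; linarith, by simp only; linarith⟩⟩

theorem isClosed_stdTet : IsClosed stdTet :=
  (isClosed_le continuous_const continuous_fst).inter
    ((isClosed_stdTri.preimage continuous_snd).inter
      (isClosed_le (f := fun z : ℝ × ℝ × ℝ => z.1 + (z.2.1 + z.2.2)) (by fun_prop)
        continuous_const))

theorem isCompact_stdTet : IsCompact stdTet := by
  refine (isCompact_Icc (a := (0 : ℝ)) (b := 1) |>.prod isCompact_stdTri).of_isClosed_subset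
    isClosed_stdTet ?_
  rintro ⟨r, s, t⟩ ⟨h1, ⟨h2, h2', h3⟩, h4⟩
  simp only at h1 h2 h2' h3 h4
  exact ⟨⟨h1, by simp only; linarith⟩, ⟨h2, h2', h3⟩⟩

/-- Fubini for the region between zero and the graph of `l` over `D`. -/
theorem setIntegral_under_graph {Y : Type*} [MeasureSpace Y] [SFinite (volume : Measure Y)]
    {D : Set Y} (hD : MeasurableSet D) {l : Y → ℝ} (hl : ∀ y ∈ D, 0 ≤ l y)
    {Ω : Set (ℝ × Y)} (hΩm : MeasurableSet Ω)
    (hΩ : ∀ s y, (s, y) ∈ Ω ↔ y ∈ D ∧ 0 ≤ s ∧ s ≤ l y)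
    (h : ℝ × Y → ℝ) (hi : IntegrableOn h Ω) :
    ∫ z in Ω, h z = ∫ y in D, ∫ s in (0 : ℝ)..l y, h (s, y) := by
  rw [← integral_indicator hΩm, Measure.volume_eq_prod, integral_prod_symm,
    ← integral_indicator hD]
  · congr 1
    ext y
    by_cases hy : y ∈ D
    · rw [indicator_of_mem hy, intervalIntegral.integral_of_le (hl y hy),
        ← integral_Icc_eq_integral_Ioc, ← integral_indicator measurableSet_Icc]
      congr 1
      ext s
      by_cases hs : s ∈ Icc 0 (l y)
      · rw [indicator_of_mem hs, indicator_of_mem ((hΩ s y).2 ⟨hy, hs.1, hs.2⟩)]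
      · rw [indicator_of_notMem hs,
          indicator_of_notMem fun hz => hs ⟨((hΩ s y).1 hz).2.1, ((hΩ s y).1 hz).2.2⟩]
    · rw [indicator_of_notMem hy]
      have : ∀ s, indicator Ω h (s, y) = 0 := fun s =>
        indicator_of_notMem (fun hz => hy ((hΩ s y).1 hz).1) _
      simp [this]
  · exact (integrable_indicator_iff hΩm).2 hi

variable {E : Type*} [NormedAddCommGroup E] [NormedSpace ℝ E]

/-- The affine parametrization of a segment. -/
def segPt (a b : E) (t : ℝ) : E := a + t • (b - a)

/-- The affine parametrization of a triangle. -/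
def triPt (a b c : E) (q : ℝ × ℝ) : E := a + q.1 • (b - a) + q.2 • (c - a)

/-- The affine parametrization of a tetrahedron. -/
def tetPt (a b c d : E) (z : ℝ × ℝ × ℝ) : E :=
  a + z.1 • (b - a) + z.2.1 • (c - a) + z.2.2 • (d - a)

/-- The mean of `h` over a segment. -/
noncomputable def segInt (a b : E) (h : E → ℝ) : ℝ := ∫ t in (0 : ℝ)..1, h (segPt a b t)

/-- The integral of `h` over a triangle in affine coordinates. -/
noncomputable def triInt (a b c : E) (h : E → ℝ) : ℝ := ∫ q in stdTri, h (triPt a b c q)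

/-- The integral of `h` over a tetrahedron in affine coordinates. -/
noncomputable def tetInt (a b c d : E) (h : E → ℝ) : ℝ := ∫ z in stdTet, h (tetPt a b c d z)

theorem continuous_triPt (a b c : E) : Continuous (triPt a b c) := by
  unfold triPt; fun_prop

theorem continuous_tetPt (a b c d : E) : Continuous (tetPt a b c d) := by
  unfold tetPt; fun_prop

theorem triInt_swap_right (a b c : E) (h : E → ℝ) : triInt a c b h = triInt a b c h := by
  have hm : MeasurePreserving (Prod.swap : ℝ × ℝ → ℝ × ℝ) := Measure.measurePreserving_swap
  have he : MeasurableEmbedding (Prod.swap : ℝ × ℝ → ℝ × ℝ) :=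
    MeasurableEquiv.prodComm.measurableEmbedding
  have := hm.setIntegral_preimage_emb he (fun q => h (triPt a b c q)) stdTri
  rw [triInt, triInt, ← this]
  have hs : Prod.swap ⁻¹' stdTri = stdTri := by
    ext ⟨s, t⟩
    simp only [stdTri, mem_preimage, mem_ofPred_eq, Prod.swap]
    rw [add_comm t s]; tauto
  rw [hs]
  congr 1
  ext q
  simp only [triPt, Prod.swap]
  congr 1
  abel

theorem measurePreserving_shear :
    MeasurePreserving (fun q : ℝ × ℝ => (q.1, (1 - q.1) - q.2)) := by
  refine (MeasurePreserving.id (volume : Measure ℝ)).skew_product (g := fun s t => (1 - s) - t)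
    (by fun_prop) (.of_forall fun s => ?_)
  exact (Measure.measurePreserving_sub_left volume (1 - s)).map_eq

/-- The shear `(s, t) ↦ (s, 1 - s - t)` preserves measure and the standard triangle, and it
exchanges the barycentric weights of `a` and `c`. -/
theorem triInt_swap_outer (a b c : E) (h : E → ℝ) : triInt c b a h = triInt a b c h := by
  have he : MeasurableEmbedding (fun q : ℝ × ℝ => (q.1, (1 - q.1) - q.2)) := by
    let e : ℝ × ℝ ≃ᵐ ℝ × ℝ :=
      { toFun := fun q => (q.1, (1 - q.1) - q.2)
        invFun := fun q => (q.1, (1 - q.1) - q.2)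
        left_inv := fun q => by ext <;> simp
        right_inv := fun q => by ext <;> simp
        measurable_toFun := by simp only [Equiv.coe_fn_mk]; fun_prop
        measurable_invFun := by simp only [Equiv.coe_fn_symm_mk]; fun_prop }
    exact e.measurableEmbedding
  have := measurePreserving_shear.setIntegral_preimage_emb he (fun q => h (triPt a b c q)) stdTri
  rw [triInt, triInt, ← this]
  have hs : (fun q : ℝ × ℝ => (q.1, (1 - q.1) - q.2)) ⁻¹' stdTri = stdTri := by
    ext ⟨s, t⟩
    simp only [stdTri, mem_preimage, mem_ofPred_eq]
    constructor <;> rintro ⟨h1, h2, h3⟩ <;> refine ⟨h1, ?_, ?_⟩ <;> linarith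
  rw [hs]
  congr 1
  ext q
  simp only [triPt]
  congr 1
  module

theorem continuousOn_fderiv_apply {g : E → ℝ} {F : Set E} (hg : ∀ x ∈ F, ContDiffAt ℝ 1 g x)
    (d : E) : ContinuousOn (fun x => fderiv ℝ g x d) F := fun x hx =>
  (((hg x hx).fderiv_right (m := 0) (by norm_num)).continuousAt.clm_apply
    continuousAt_const).continuousWithinAt

/-- The fundamental theorem of calculus along a segment in direction `d`. -/
theorem integral_fderiv_line {g : E → ℝ} {x d : E} {r : ℝ} (hr : 0 ≤ r)
    (hg : ∀ s ∈ Icc 0 r, ContDiffAt ℝ 1 g (x + s • d)) :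
    ∫ s in (0 : ℝ)..r, fderiv ℝ g (x + s • d) d = g (x + r • d) - g x := by
  have hline : ∀ s : ℝ, HasDerivAt (fun s : ℝ => x + s • d) d s := fun s => by
    simpa using ((hasDerivAt_id s).smul_const d).const_add x
  rw [intervalIntegral.integral_eq_sub_of_hasDerivAt (f := fun s => g (x + s • d))]
  · simp
  · intro s hs
    rw [uIcc_of_le hr] at hs
    exact ((hg s hs).differentiableAt one_ne_zero).hasFDerivAt.comp_hasDerivAt s (hline s)
  · refine ContinuousOn.intervalIntegrable ?_
    rw [uIcc_of_le hr]
    refine (continuousOn_fderiv_apply (F := (fun s : ℝ => x + s • d) '' Icc 0 r) ?_ d).comp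
      (by fun_prop) (mapsTo_image _ _)
    rintro _ ⟨s, hs, rfl⟩
    exact hg s hs

/-- The gradient theorem on a triangle, in affine coordinates. -/
theorem triInt_fderiv {a b c : E} {g : E → ℝ}
    (hg : ∀ q ∈ stdTri, ContDiffAt ℝ 1 g (triPt a b c q)) :
    triInt a b c (fun x => fderiv ℝ g x (b - a)) = segInt b c g - segInt a c g := by
  have hc : ContinuousOn (fun q => fderiv ℝ g (triPt a b c q) (b - a)) stdTri := by
    refine (continuousOn_fderiv_apply (F := triPt a b c '' stdTri) ?_ (b - a)).comp
      (continuous_triPt a b c).continuousOn (mapsTo_image _ _)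
    rintro _ ⟨q, hq, rfl⟩
    exact hg q hq
  have hΩ : ∀ s t : ℝ, (s, t) ∈ stdTri ↔ t ∈ Icc (0 : ℝ) 1 ∧ 0 ≤ s ∧ s ≤ 1 - t := fun s t => by
    simp only [stdTri, mem_ofPred_eq, mem_Icc]
    constructor
    · rintro ⟨h1, h2, h3⟩
      exact ⟨⟨h2, by linarith⟩, h1, by linarith⟩
    · rintro ⟨⟨h1, h2⟩, h3, h4⟩
      exact ⟨h3, h1, by linarith⟩
  have hline : ∀ s t, triPt a b c (s, t) = segPt a c t + s • (b - a) := fun s t => by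
    simp only [triPt, segPt]; abel
  have hend : ∀ t, segPt b c t = triPt a b c (1 - t, t) := fun t => by
    simp only [triPt, segPt]; module
  have hstart : ∀ t, segPt a c t = triPt a b c (0, t) := fun t => by
    simp only [triPt, segPt]; module
  -- Integrate first along the lines parallel to `b - a`: they start on the edge `ac` and end on the
  -- edge `bc`.
  rw [triInt, setIntegral_under_graph (D := Icc (0 : ℝ) 1) (l := fun t => 1 - t) measurableSet_Icc
    (fun t ht => by linarith [ht.2]) isClosed_stdTri.measurableSet hΩ
    _ (hc.integrableOn_compact isCompact_stdTri), integral_Icc_eq_integral_Ioc,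
    ← intervalIntegral.integral_of_le zero_le_one, segInt, segInt,
    ← intervalIntegral.integral_sub]
  · refine intervalIntegral.integral_congr fun t ht => ?_
    rw [uIcc_of_le zero_le_one] at ht
    simp only [hline]
    rw [integral_fderiv_line (by linarith [ht.2])
      (fun s hs => hline s t ▸ hg _ ((hΩ s t).2 ⟨ht, hs.1, hs.2⟩)), hend, hline]
  · refine ContinuousOn.intervalIntegrable fun t ht => ?_
    rw [uIcc_of_le zero_le_one] at ht
    simp only [hend]
    exact (ContinuousAt.comp (f := fun t => triPt a b c (1 - t, t))
      (hg _ ((hΩ _ t).2 ⟨ht, by linarith [ht.2], le_rfl⟩)).continuousAt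
      ((continuous_triPt a b c).comp (by fun_prop)).continuousAt).continuousWithinAt
  · refine ContinuousOn.intervalIntegrable fun t ht => ?_
    rw [uIcc_of_le zero_le_one] at ht
    simp only [hstart]
    exact (ContinuousAt.comp (f := fun t => triPt a b c (0, t))
      (hg _ ((hΩ _ t).2 ⟨ht, le_rfl, by linarith [ht.2]⟩)).continuousAt
      ((continuous_triPt a b c).comp (by fun_prop)).continuousAt).continuousWithinAt

/-- The gradient theorem on a tetrahedron, in affine coordinates. -/
theorem tetInt_fderiv {a b c d : E} {g : E → ℝ}
    (hg : ∀ z ∈ stdTet, ContDiffAt ℝ 1 g (tetPt a b c d z)) :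
    tetInt a b c d (fun x => fderiv ℝ g x (b - a)) = triInt b c d g - triInt a c d g := by
  have hc : ContinuousOn (fun z => fderiv ℝ g (tetPt a b c d z) (b - a)) stdTet := by
    refine (continuousOn_fderiv_apply (F := tetPt a b c d '' stdTet) ?_ (b - a)).comp
      (continuous_tetPt a b c d).continuousOn (mapsTo_image _ _)
    rintro _ ⟨q, hq, rfl⟩
    exact hg q hq
  have hΩ : ∀ s q, (s, q) ∈ stdTet ↔ q ∈ stdTri ∧ 0 ≤ s ∧ s ≤ 1 - q.1 - q.2 := fun s q => by
    simp only [stdTet, mem_ofPred_eq]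
    constructor
    · rintro ⟨h1, h2, h3⟩
      exact ⟨h2, h1, by linarith⟩
    · rintro ⟨h1, h3, h4⟩
      exact ⟨h3, h1, by linarith⟩
  have hline : ∀ s q, tetPt a b c d (s, q) = triPt a c d q + s • (b - a) := fun s t => by
    simp only [triPt, tetPt]; abel
  have hend : ∀ q, triPt b c d q = tetPt a b c d (1 - q.1 - q.2, q) := fun t => by
    simp only [triPt, tetPt]; module
  have hstart : ∀ q, triPt a c d q = tetPt a b c d (0, q) := fun t => by
    simp only [triPt, tetPt]; module
  have hl : ∀ q ∈ stdTri, 0 ≤ 1 - q.1 - q.2 := fun q hq => by linarith [hq.2.2]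
  rw [tetInt, setIntegral_under_graph isClosed_stdTri.measurableSet
    (l := fun q => 1 - q.1 - q.2) hl isClosed_stdTet.measurableSet hΩ
    _ (hc.integrableOn_compact isCompact_stdTet), triInt, triInt, ← integral_sub]
  · refine setIntegral_congr_fun isClosed_stdTri.measurableSet fun q hq => ?_
    simp only [hline]
    rw [integral_fderiv_line (hl q hq)
      (fun s hs => hline s q ▸ hg _ ((hΩ s q).2 ⟨hq, hs.1, hs.2⟩)), hend, hline]
  · refine ContinuousOn.integrableOn_compact isCompact_stdTri fun q hq => ?_
    simp only [hend]
    exact (ContinuousAt.comp (f := fun q : ℝ × ℝ => tetPt a b c d (1 - q.1 - q.2, q))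
      (hg _ ((hΩ _ q).2 ⟨hq, hl q hq, le_rfl⟩)).continuousAt
      ((continuous_tetPt a b c d).comp (by fun_prop)).continuousAt).continuousWithinAt
  · refine ContinuousOn.integrableOn_compact isCompact_stdTri fun q hq => ?_
    simp only [hstart]
    exact (ContinuousAt.comp (f := fun q : ℝ × ℝ => tetPt a b c d (0, q))
      (hg _ ((hΩ _ q).2 ⟨hq, le_rfl, hl q hq⟩)).continuousAt
      ((continuous_tetPt a b c d).comp (by fun_prop)).continuousAt).continuousWithinAt

end Analysis

/-! ### Vector algebra in three-space. -/

section Cross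

theorem inner_E3 (x y : E3) : ⟪x, y⟫ = x 0 * y 0 + x 1 * y 1 + x 2 * y 2 := by
  simp [PiLp.inner_apply, Fin.sum_univ_three, mul_comm]

theorem cross_apply_zero (x y : E3) : cross x y 0 = x 1 * y 2 - x 2 * y 1 := by
  simp [cross, cross_apply]

theorem cross_apply_one (x y : E3) : cross x y 1 = x 2 * y 0 - x 0 * y 2 := by
  simp [cross, cross_apply]

theorem cross_apply_two (x y : E3) : cross x y 2 = x 0 * y 1 - x 1 * y 0 := by
  simp [cross, cross_apply]

theorem E3_ext {x y : E3} (h0 : x 0 = y 0) (h1 : x 1 = y 1) (h2 : x 2 = y 2) : x = y := by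
  ext i; fin_cases i <;> assumption

theorem cross_cross_left (x y z : E3) :
    cross (cross x y) z = ⟪x, z⟫ • y - ⟪y, z⟫ • x := by
  apply E3_ext <;> simp only [inner_E3, cross_apply_zero, cross_apply_one, cross_apply_two,
    PiLp.sub_apply, PiLp.smul_apply, smul_eq_mul] <;> ring

theorem cross_cross_right (x y z : E3) :
    cross x (cross y z) = ⟪x, z⟫ • y - ⟪x, y⟫ • z := by
  apply E3_ext <;> simp only [inner_E3, cross_apply_zero, cross_apply_one, cross_apply_two,
    PiLp.sub_apply, PiLp.smul_apply, smul_eq_mul] <;> ring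

theorem inner_cross_cyclic (x y z : E3) : ⟪cross x y, z⟫ = ⟪cross y z, x⟫ := by
  simp only [inner_E3, cross_apply_zero, cross_apply_one, cross_apply_two]; ring

theorem inner_cross_left (x y : E3) : ⟪cross x y, x⟫ = 0 := by
  simp only [inner_E3, cross_apply_zero, cross_apply_one, cross_apply_two]; ring

theorem inner_cross_right (x y : E3) : ⟪cross x y, y⟫ = 0 := by
  simp only [inner_E3, cross_apply_zero, cross_apply_one, cross_apply_two]; ring

theorem cross_swap (x y : E3) : cross y x = -cross x y := by
  apply E3_ext <;> simp only [cross_apply_zero, cross_apply_one, cross_apply_two,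
    PiLp.neg_apply] <;> ring

theorem cross_add_left (x y z : E3) : cross (x + y) z = cross x z + cross y z := by
  apply E3_ext <;> simp only [cross_apply_zero, cross_apply_one, cross_apply_two,
    PiLp.add_apply] <;> ring

theorem cross_smul_left (k : ℝ) (x y : E3) : cross (k • x) y = k • cross x y := by
  apply E3_ext <;> simp only [cross_apply_zero, cross_apply_one, cross_apply_two,
    PiLp.smul_apply, smul_eq_mul] <;> ring

theorem cross_smul_right (k : ℝ) (x y : E3) : cross x (k • y) = k • cross x y := by
  apply E3_ext <;> simp only [cross_apply_zero, cross_apply_one, cross_apply_two,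
    PiLp.smul_apply, smul_eq_mul] <;> ring

theorem norm_sq_cross (x y : E3) : ‖cross x y‖ ^ 2 = ‖x‖ ^ 2 * ‖y‖ ^ 2 - ⟪x, y⟫ ^ 2 := by
  simp only [← real_inner_self_eq_norm_sq, inner_E3, cross_apply_zero, cross_apply_one,
    cross_apply_two]
  ring

/-- A unit vector orthogonal to `x` and `y` is a multiple of `x × y` unless that vanishes. -/
theorem abs_inner_mul_norm_cross {η x y : E3} (hη : ‖η‖ = 1) (hx : ⟪η, x⟫ = 0) (hy : ⟪η, y⟫ = 0)
    (z : E3) : |⟪η, z⟫| * ‖cross x y‖ = |⟪cross x y, z⟫| := by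
  have h0 : cross η (cross x y) = 0 := by rw [cross_cross_right, hx, hy]; simp
  -- Expand the vanishing product `η × (η × (x × y))` by the triple product formula, with `‖η‖ = 1`.
  have h1 : cross x y = ⟪η, cross x y⟫ • η := by
    have := cross_cross_right η η (cross x y)
    have hz : cross η 0 = 0 := by
      have := cross_smul_right 0 η 0
      simpa using this
    rw [h0, real_inner_self_eq_norm_sq, hη, hz] at this
    simpa using (sub_eq_zero.1 this.symm).symm
  set k := ⟪η, cross x y⟫
  rw [h1, norm_smul, hη, inner_smul_left, abs_mul]
  simp [mul_comm]

end Cross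

/-! ### Surface integrals over a triangle. -/

section Faces

/-- The integral of `h` over the triangle with vertices `q`. -/
noncomputable def faceInt (q : Fin 3 → E3) (h : E3 → ℝ) : ℝ :=
  ‖cross (q 1 - q 0) (q 2 - q 0)‖ * triInt (q 0) (q 1) (q 2) h

theorem norm_cross_perm (a b c : E3) :
    ‖cross (c - a) (b - a)‖ = ‖cross (b - a) (c - a)‖ ∧
    ‖cross (b - c) (a - c)‖ = ‖cross (b - a) (c - a)‖ := by
  constructor
  · rw [cross_swap, norm_neg]
  · rw [← norm_neg]
    congr 1
    apply E3_ext <;> simp only [cross_apply_zero, cross_apply_one, cross_apply_two,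
      PiLp.neg_apply, PiLp.sub_apply] <;> ring

/-- This makes the arbitrary numbering of the vertices of a face harmless. Transpositions generate
the permutations; two of them come from the swaps of `triInt`, and the third is a conjugate. -/
theorem faceInt_perm (σ : Equiv.Perm (Fin 3)) (q : Fin 3 → E3) (h : E3 → ℝ) :
    faceInt (q ∘ σ) h = faceInt q h := by
  have key : ∀ a b c : E3, faceInt ![a, c, b] h = faceInt ![a, b, c] h ∧
      faceInt ![c, b, a] h = faceInt ![a, b, c] h := fun a b c => by
    simp only [faceInt, Matrix.cons_val]
    rw [triInt_swap_right, triInt_swap_outer, (norm_cross_perm a b c).1, (norm_cross_perm a b c).2]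
    exact ⟨rfl, rfl⟩
  have hq : ∀ r : Fin 3 → E3, faceInt r h = faceInt ![r 0, r 1, r 2] h := fun r => by
    simp [faceInt]
  induction σ using Equiv.Perm.swap_induction_on generalizing q with
  | one => rfl
  | swap_mul f x y hxy ih =>
    rw [Equiv.Perm.coe_mul, ← Function.comp_assoc, ih, hq, hq q]
    obtain ⟨k1, k2⟩ := key (q 0) (q 1) (q 2)
    have k3 : faceInt ![q 1, q 0, q 2] h = faceInt ![q 0, q 1, q 2] h := by
      rw [(key (q 1) (q 2) (q 0)).1, ← (key _ _ _).2, (key (q 0) (q 1) (q 2)).1]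
    fin_cases x <;> fin_cases y <;> simp at hxy <;>
      simp [Equiv.swap_apply_def, k1, k2, k3]

end Faces

/-! ### Volume integrals over a tetrahedron by an affine change of variables. -/

section Volume

open MeasureTheory Set

/-- The coordinates of a point of `E3` as an element of `ℝ × ℝ × ℝ`. -/
noncomputable def coordEquiv : E3 ≃ᵐ ℝ × ℝ × ℝ :=
  (MeasurableEquiv.toLp 2 (Fin 3 → ℝ)).symm.trans
    ((MeasurableEquiv.piFinSuccAbove (fun _ => ℝ) 0).trans
      ((MeasurableEquiv.refl ℝ).prodCongr MeasurableEquiv.finTwoArrow))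

theorem coordEquiv_apply (x : E3) : coordEquiv x = (x 0, x 1, x 2) := rfl

theorem measurePreserving_coordEquiv : MeasurePreserving coordEquiv :=
  (EuclideanSpace.volume_preserving_symm_measurableEquiv_toLp (Fin 3)).trans
    ((volume_preserving_piFinSuccAbove (fun _ : Fin 3 => ℝ) 0).trans
      ((MeasurePreserving.id volume).prod (volume_preserving_finTwoArrow ℝ)))

/-- The linear map with columns `x, y, z`. -/
noncomputable def columnMap (x y z : E3) : E3 →L[ℝ] E3 :=
  (EuclideanSpace.proj 0).smulRight x + (EuclideanSpace.proj 1).smulRight y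
    + (EuclideanSpace.proj 2).smulRight z

theorem columnMap_apply (x y z p : E3) : columnMap x y z p = p 0 • x + p 1 • y + p 2 • z := rfl

theorem det_columnMap (x y z : E3) : (columnMap x y z).det = ⟪cross y z, x⟫ := by
  rw [ContinuousLinearMap.det,
    ← LinearMap.det_toMatrix (EuclideanSpace.basisFun (Fin 3) ℝ).toBasis, Matrix.det_fin_three]
  simp [LinearMap.toMatrix_apply, columnMap_apply, inner_E3, cross_apply_zero, cross_apply_one,
    cross_apply_two]
  ring

theorem tetPt_coordEquiv (a b c d p : E3) :
    tetPt a b c d (coordEquiv p) = a + columnMap (b - a) (c - a) (d - a) p := by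
  rw [columnMap_apply, tetPt, coordEquiv_apply]
  simp only; abel

theorem tetPt_mem_tetrahedron (P : Fin 4 → E3) {z : ℝ × ℝ × ℝ} (hz : z ∈ stdTet) :
    tetPt (P 0) (P 1) (P 2) (P 3) z ∈ tetrahedron P := by
  obtain ⟨h1, ⟨h2, h3, -⟩, h4⟩ := hz
  have : tetPt (P 0) (P 1) (P 2) (P 3) z
      = ∑ i, (![1 - (z.1 + (z.2.1 + z.2.2)), z.1, z.2.1, z.2.2] : Fin 4 → ℝ) i • P i := by
    simp only [tetPt, Fin.sum_univ_four, Matrix.cons_val]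
    module
  rw [this]
  refine (convex_convexHull ℝ _).sum_mem ?_ ?_ fun i _ => subset_convexHull ℝ _ (mem_range_self i)
  · intro i _
    fin_cases i <;> simp <;> linarith
  · simp [Fin.sum_univ_four]; ring

theorem tetrahedron_eq_image (P : Fin 4 → E3) :
    tetrahedron P = tetPt (P 0) (P 1) (P 2) (P 3) '' stdTet := by
  apply Subset.antisymm
  · refine convexHull_min ?_ ?_
    · rintro _ ⟨i, rfl⟩
      refine ⟨![(0, 0, 0), (1, 0, 0), (0, 1, 0), (0, 0, 1)] i, ?_, ?_⟩
      · fin_cases i <;> simp [stdTet, stdTri]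
      · fin_cases i <;> simp [tetPt]
    · rintro _ ⟨y, ⟨hy1, ⟨hy2, hy3, -⟩, hy4⟩, rfl⟩ _ ⟨z, ⟨hz1, ⟨hz2, hz3, -⟩, hz4⟩, rfl⟩ a b ha hb hab
      have h4 : a * y.1 + b * z.1 + ((a * y.2.1 + b * z.2.1) + (a * y.2.2 + b * z.2.2)) ≤ 1 := by
        nlinarith
      have h1 : 0 ≤ a * y.1 + b * z.1 := by positivity
      refine ⟨(a * y.1 + b * z.1, a * y.2.1 + b * z.2.1, a * y.2.2 + b * z.2.2),
        ⟨h1, ⟨by simp only; positivity, by simp only; positivity, ?_⟩, h4⟩, ?_⟩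
      · simp only; linarith
      · obtain rfl : b = 1 - a := by linarith
        simp only [tetPt]
        module
  · rintro _ ⟨z, hz, rfl⟩
    exact tetPt_mem_tetrahedron P hz

theorem isCompact_tetrahedron (P : Fin 4 → E3) : IsCompact (tetrahedron P) :=
  tetrahedron_eq_image P ▸ isCompact_stdTet.image (continuous_tetPt _ _ _ _)

theorem columnMap_injective {P : Fin 4 → E3} (hP : AffineIndependent ℝ P) :
    Function.Injective (columnMap (P 1 - P 0) (P 2 - P 0) (P 3 - P 0)) := by
  rw [affineIndependent_iff_linearIndependent_vsub ℝ _ 0] at hP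
  have hP' := hP.comp (fun k : Fin 3 => (⟨k.succ, Fin.succ_ne_zero k⟩ : {i : Fin 4 // i ≠ 0}))
    fun k l hkl => Fin.succ_injective _ (congrArg Subtype.val hkl)
  rw [Fintype.linearIndependent_iff] at hP'
  refine (injective_iff_map_eq_zero _).2 fun x hx => ?_
  have := hP' x (by simpa [Fin.sum_univ_three, columnMap_apply] using hx)
  ext k
  simpa using this k

/-- Integrals over a tetrahedron in affine coordinates. -/
theorem setIntegral_tetrahedron {P : Fin 4 → E3} (hP : AffineIndependent ℝ P) (h : E3 → ℝ) :
    ∫ x in tetrahedron P, h x =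
      |⟪cross (P 2 - P 0) (P 3 - P 0), P 1 - P 0⟫| * tetInt (P 0) (P 1) (P 2) (P 3) h := by
  set A := columnMap (P 1 - P 0) (P 2 - P 0) (P 3 - P 0) with hA
  have him : tetrahedron P = (fun p => P 0 + A p) '' (coordEquiv ⁻¹' stdTet) := by
    rw [tetrahedron_eq_image, ← image_image (fun x => P 0 + x) A]
    ext x
    simp only [mem_image, mem_preimage, exists_exists_and_eq_and]
    constructor
    · rintro ⟨z, hz, rfl⟩
      refine ⟨coordEquiv.symm z, by simpa using hz, ?_⟩
      rw [← tetPt_coordEquiv]; simp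
    · rintro ⟨p, hp, rfl⟩
      exact ⟨_, hp, tetPt_coordEquiv _ _ _ _ _⟩
  rw [him, integral_image_eq_integral_abs_det_fderiv_smul volume
    (coordEquiv.measurable isClosed_stdTet.measurableSet)
    (fun x _ => (A.hasFDerivAt.const_add (P 0)).hasFDerivWithinAt)
    (fun x _ y _ hxy => columnMap_injective hP (add_left_cancel hxy)),
    hA, det_columnMap, tetInt, ← measurePreserving_coordEquiv.setIntegral_preimage_emb
      coordEquiv.measurableEmbedding]
  simp only [tetPt_coordEquiv, smul_eq_mul]
  rw [integral_const_mul]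

end Volume

/-! ### Gradient theorem on the tetrahedron with outer normals. -/

section GradientTheorem

open MeasureTheory Set

variable {P : Fin 4 → E3} {ν : (j : Fin 4) → Fin 3 ≃ {i : Fin 4 // i ≠ j}}
  {p : Fin 4 → Fin 3 → E3} {η : Fin 4 → E3}

theorem mem_face (hp : ∀ j k, p j k = P (ν j k)) {i j : Fin 4} (hij : i ≠ j) :
    P i ∈ convexHull ℝ (range (p j)) :=
  subset_convexHull ℝ _ ⟨(ν j).symm ⟨i, hij⟩, by simp [hp]⟩

/-- The given numbering of a face and the one induced by `τ` list the same vertices, so they differ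
by a permutation. -/
theorem faceInt_eq_of_numbering (hp : ∀ j k, p j k = P (ν j k)) (τ : Equiv.Perm (Fin 4))
    (l : Fin 4) (g : E3 → ℝ) :
    faceInt (p (τ l)) g = faceInt (fun k => P (τ (l.succAbove k))) g := by
  let r : Fin 3 ≃ {i : Fin 4 // i ≠ τ l} := (finSuccAboveEquiv l).trans
    (τ.subtypeEquiv fun a => (τ.injective.ne_iff (x := a) (y := l)).symm)
  have hr : p (τ l) = (fun k => P (τ (l.succAbove k))) ∘ ((ν (τ l)).trans r.symm) := by
    ext1 k
    have : τ (l.succAbove (r.symm (ν (τ l) k))) = (r (r.symm (ν (τ l) k))).1 := rfl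
    simp only [Function.comp, Equiv.trans_apply, this, Equiv.apply_symm_apply, hp]
  rw [hr, faceInt_perm]

theorem tetrahedron_comp_perm (P : Fin 4 → E3) (τ : Equiv.Perm (Fin 4)) :
    tetrahedron (P ∘ τ) = tetrahedron P := by
  rw [tetrahedron, EquivLike.range_comp, tetrahedron]

/-- The gradient theorem in the direction of an edge. -/
theorem setIntegral_fderiv_edge (hP : AffineIndependent ℝ P)
    (hp : ∀ j k, p j k = P (ν j k))
    (hη : ∀ j, IsUnitOuterNormal (tetrahedron P) (convexHull ℝ (range (p j))) (η j))
    {g : E3 → ℝ} (hg : ∀ x ∈ tetrahedron P, ContDiffAt ℝ 1 g x) (τ : Equiv.Perm (Fin 4)) :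
    ∫ x in tetrahedron P, fderiv ℝ g x (P (τ 1) - P (τ 0)) =
      ∑ j, ⟪η j, P (τ 1) - P (τ 0)⟫ * faceInt (p j) g := by
  have horth : ∀ j a b, τ a ≠ j → τ b ≠ j → ⟪η j, P (τ a) - P (τ b)⟫ = 0 := fun j a b ha hb =>
    (hη j).2.1 _ (mem_face hp ha) _ (mem_face hp hb)
  have hout : ∀ j a, τ a ≠ j → ⟪η j, P j - P (τ a)⟫ ≤ 0 := fun j a ha =>
    (hη j).2.2 _ (subset_convexHull ℝ _ (mem_range_self j)) _ (mem_face hp ha)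
  have hne : ∀ a b, a ≠ b → τ a ≠ τ b := fun a b => τ.injective.ne
  have htri : ∀ a b c d : E3, ⟪cross (c - b) (d - b), b - a⟫ = ⟪cross (c - a) (d - a), b - a⟫ := by
    intro a b c d
    simp only [inner_E3, cross_apply_zero, cross_apply_one, cross_apply_two, PiLp.sub_apply]
    ring
  rw [← Equiv.sum_comp τ, ← tetrahedron_comp_perm P τ, setIntegral_tetrahedron
    (P := P ∘ τ) (hP.comp_embedding τ.toEmbedding), Fin.sum_univ_four]
  simp only [Function.comp]
  -- The edge lies in the faces opposite `τ 2` and `τ 3`, whose normals are orthogonal to it. Only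
  -- the faces opposite its two endpoints contribute.
  rw [tetInt_fderiv, horth (τ 2) 1 0 (hne _ _ (by decide)) (hne _ _ (by decide)),
    horth (τ 3) 1 0 (hne _ _ (by decide)) (hne _ _ (by decide)),
    faceInt_eq_of_numbering hp τ 0, faceInt_eq_of_numbering hp τ 1]
  -- On each remaining face, `|⟪η, edge⟫|` times twice the face area is the absolute value of the
  -- determinant in the volume formula. The edge direction points outward at the face opposite its
  -- start and inward at the face opposite its end, which fixes both signs.
  · have e0 := abs_inner_mul_norm_cross (hη (τ 0)).1
      (horth (τ 0) 2 1 (hne _ _ (by decide)) (hne _ _ (by decide)))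
      (horth (τ 0) 3 1 (hne _ _ (by decide)) (hne _ _ (by decide))) (P (τ 1) - P (τ 0))
    have e1 := abs_inner_mul_norm_cross (hη (τ 1)).1
      (horth (τ 1) 2 0 (hne _ _ (by decide)) (hne _ _ (by decide)))
      (horth (τ 1) 3 0 (hne _ _ (by decide)) (hne _ _ (by decide))) (P (τ 1) - P (τ 0))
    have s0 := hout (τ 0) 1 (hne _ _ (by decide))
    have s1 := hout (τ 1) 0 (hne _ _ (by decide))
    rw [← neg_sub, inner_neg_right, Left.neg_nonpos_iff] at s0
    rw [htri, abs_of_nonneg s0] at e0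
    rw [abs_of_nonpos s1] at e1
    simp only [faceInt, Fin.succAbove_zero, Fin.succ_zero_eq_one, Fin.succ_one_eq_two,
      show (1 : Fin 4).succAbove 0 = 0 from rfl, show (1 : Fin 4).succAbove 1 = 2 from rfl,
      show (1 : Fin 4).succAbove 2 = 3 from rfl, show (2 : Fin 3).succ = 3 from rfl]
    linear_combination (-triInt (P (τ 1)) (P (τ 2)) (P (τ 3)) g) * e0
      + triInt (P (τ 0)) (P (τ 2)) (P (τ 3)) g * e1
  · intro z hz
    rw [← tetrahedron_comp_perm P τ] at hg
    exact hg _ (tetPt_mem_tetrahedron (P ∘ τ) hz)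

/-- The gradient theorem on a tetrahedron. -/
theorem setIntegral_fderiv_tetrahedron (hP : AffineIndependent ℝ P)
    (hp : ∀ j k, p j k = P (ν j k))
    (hη : ∀ j, IsUnitOuterNormal (tetrahedron P) (convexHull ℝ (range (p j))) (η j))
    {g : E3 → ℝ} (hg : ∀ x ∈ tetrahedron P, ContDiffAt ℝ 1 g x) (d : E3) :
    ∫ x in tetrahedron P, fderiv ℝ g x d = ∑ j, ⟪η j, d⟫ * faceInt (p j) g := by
  have hi : ∀ d, IntegrableOn (fun x => fderiv ℝ g x d) (tetrahedron P) := fun d =>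
    (continuousOn_fderiv_apply hg d).integrableOn_compact (isCompact_tetrahedron P)
  -- The three permutations fix `0` and send `1` to `1`, `2`, `3`. The corresponding edges at `P 0`
  -- span the space, and both sides are linear in `d`.
  have h1 := setIntegral_fderiv_edge hP hp hη hg 1
  have h2 := setIntegral_fderiv_edge hP hp hη hg (Equiv.swap 1 2)
  have h3 := setIntegral_fderiv_edge hP hp hη hg (Equiv.swap 1 3)
  simp only [Equiv.Perm.one_apply, Equiv.swap_apply_left,
    Equiv.swap_apply_of_ne_of_ne (show (0 : Fin 4) ≠ 1 by decide) (show (0 : Fin 4) ≠ 2 by decide),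
    Equiv.swap_apply_of_ne_of_ne (show (0 : Fin 4) ≠ 1 by decide)
      (show (0 : Fin 4) ≠ 3 by decide)] at h1 h2 h3
  obtain ⟨c, rfl⟩ := (LinearMap.injective_iff_surjective
    (f := (columnMap (P 1 - P 0) (P 2 - P 0) (P 3 - P 0)).toLinearMap)).1
    (columnMap_injective hP) d
  simp only [ContinuousLinearMap.coe_coe, columnMap_apply, map_add, map_smul, smul_eq_mul,
    inner_add_right, inner_smul_right, add_mul, Finset.sum_add_distrib, mul_assoc]
  have hi2 : IntegrableOn (fun x => c 0 * fderiv ℝ g x (P 1 - P 0)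
      + c 1 * fderiv ℝ g x (P 2 - P 0)) (tetrahedron P) :=
    ((hi _).const_mul _).add ((hi _).const_mul _)
  rw [integral_add hi2 ((hi _).const_mul _),
    integral_add ((hi _).const_mul _) ((hi _).const_mul _)]
  simp only [integral_const_mul, h1, h2, h3, Finset.mul_sum]

end GradientTheorem

/-! ### Primitives for the edge integrals. -/

section Primitives

open Set

theorem hasDerivAt_sqrt_add_sq {c l : ℝ} (h : 0 < c + l ^ 2) :
    HasDerivAt (fun l => √(c + l ^ 2)) (l / √(c + l ^ 2)) l := by
  have h1 : HasDerivAt (fun l : ℝ => c + l ^ 2) (2 * l) l := by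
    simpa using (hasDerivAt_pow 2 l).const_add c
  convert! h1.sqrt h.ne' using 1
  field_simp

theorem abs_lt_sqrt_add_sq {c l : ℝ} (hc : 0 < c) : |l| < √(c + l ^ 2) := by
  rw [← Real.sqrt_sq_eq_abs]
  exact Real.sqrt_lt_sqrt (sq_nonneg l) (by linarith)

theorem add_sqrt_pos {c l : ℝ} (hl : 0 ≤ l) (h : 0 < c + l ^ 2) :
    0 < √(c + l ^ 2) + l := by
  have := Real.sqrt_pos.2 h
  linarith

/-- The critical case is `c = 0`, where `x₀` lies on the line of the edge. An interval that starts
below zero and avoids zero is then negative up to `l`. -/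
theorem sqrt_sub_pos {c l b : ℝ} (hc : 0 ≤ c) (a : ℝ) (ha : a < 0) (hl : l ∈ Icc a b)
    (h : ∀ l ∈ Icc a b, 0 < c + l ^ 2) : 0 < √(c + l ^ 2) - l := by
  rcases hc.eq_or_lt with rfl | hc
  · have hl0 : l < 0 := by
      by_contra! h0
      simpa using h 0 ⟨ha.le, h0.trans hl.2⟩
    have := Real.sqrt_nonneg (0 + l ^ 2)
    linarith
  · linarith [abs_lt_sqrt_add_sq (l := l) hc, le_abs_self l]

theorem hasDerivAt_log_sqrt_add {c l : ℝ} (h : 0 < c + l ^ 2) (h' : 0 < √(c + l ^ 2) + l) :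
    HasDerivAt (fun l => Real.log (√(c + l ^ 2) + l)) (√(c + l ^ 2))⁻¹ l := by
  have hs := Real.sqrt_pos.2 h
  convert! ((hasDerivAt_sqrt_add_sq h).add (hasDerivAt_id l)).log h'.ne' using 1
  simp only [Pi.add_apply, id]
  field_simp
  ring

theorem hasDerivAt_neg_log_sqrt_sub {c l : ℝ} (h : 0 < c + l ^ 2) (h' : 0 < √(c + l ^ 2) - l) :
    HasDerivAt (fun l => -Real.log (√(c + l ^ 2) - l)) (√(c + l ^ 2))⁻¹ l := by
  have hs := Real.sqrt_pos.2 h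
  convert! (((hasDerivAt_sqrt_add_sq h).sub (hasDerivAt_id l)).log h'.ne').neg using 1
  simp only [Pi.sub_apply, id]
  field_simp
  ring

theorem hasDerivAt_arctan_solid_angle {t W l : ℝ} (hW : 0 ≤ W) (ht : 0 < t ^ 2 + W ^ 2) :
    HasDerivAt (fun l => Real.arctan (t * l / (t ^ 2 + W ^ 2 + W * √(t ^ 2 + W ^ 2 + l ^ 2))))
      (t * (√(t ^ 2 + W ^ 2 + l ^ 2) * (√(t ^ 2 + W ^ 2 + l ^ 2) + W))⁻¹) l := by
  set c := t ^ 2 + W ^ 2 with hc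
  have h : 0 < c + l ^ 2 := by positivity
  have hs := Real.sqrt_pos.2 h
  have hsq : √(c + l ^ 2) ^ 2 = c + l ^ 2 := Real.sq_sqrt h.le
  have hden : 0 < c + W * √(c + l ^ 2) := by positivity
  convert! (((hasDerivAt_id l).const_mul t).div
    (((hasDerivAt_sqrt_add_sq h).const_mul W).const_add c) hden.ne').arctan using 1
  simp only [Pi.div_apply, id]
  set r := √(c + l ^ 2)
  -- With `r² = c + l²` and `c = t² + W²`, this collapses the factor `1 + (quotient)²` in the
  -- derivative of the arctangent.
  have e1 : (c + W * r) ^ 2 + (t * l) ^ 2 = c * (r + W) ^ 2 := by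
    have : l ^ 2 = r ^ 2 - c := by linarith
    have ht2 : t ^ 2 = c - W ^ 2 := by linarith
    rw [mul_pow, this, ht2]; ring
  have e2 : t * 1 * (c + W * r) - t * l * (W * (l / r)) = t * c * (r + W) / r := by
    field_simp
    linear_combination t * W * hsq
  have e3 : 1 + (t * l / (c + W * r)) ^ 2 = c * (r + W) ^ 2 / (c + W * r) ^ 2 := by
    rw [← e1]; field_simp
  rw [e2, e3]
  have : 0 < r + W := by positivity
  field_simp

end Primitives

/-! ### The orthonormal frames of a triangle and the coordinates of `x₀`. -/

namespace Tri

variable {p : Fin 3 → E3} {x₀ : E3}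

theorem cross_edges (p : Fin 3 → E3) :
    cross (p 2 - p 1) (p 0 - p 2) = cross (p 1 - p 0) (p 2 - p 0) := by
  apply E3_ext <;> simp only [cross_apply_zero, cross_apply_one, cross_apply_two,
    PiLp.sub_apply] <;> ring

theorem cross_self (x : E3) : cross x x = 0 := by
  apply E3_ext <;> simp only [cross_apply_zero, cross_apply_one, cross_apply_two,
    PiLp.zero_apply] <;> ring

theorem γ_pos (hn : cross (p 1 - p 0) (p 2 - p 0) ≠ 0) (i : Fin 3) : 0 < γ p i := by
  rw [γ, norm_pos_iff, Ne, sub_eq_zero]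
  have h0 : ∀ x : E3, cross 0 x = 0 := fun x => by simpa using cross_smul_left 0 0 x
  have h0' : ∀ x : E3, cross x 0 = 0 := fun x => by simpa using cross_smul_right 0 x 0
  intro h
  apply hn
  fin_cases i <;> simp at h
  · rw [h, cross_self]
  · rw [← h, sub_self, h0']
  · rw [h, sub_self, h0]

theorem γ_smul_s (hn : cross (p 1 - p 0) (p 2 - p 0) ≠ 0) (i : Fin 3) :
    γ p i • s p i = p (i + 2) - p (i + 1) := by
  rw [s, smul_inv_smul₀ (γ_pos hn i).ne']

theorem norm_s (hn : cross (p 1 - p 0) (p 2 - p 0) ≠ 0) (i : Fin 3) : ‖s p i‖ = 1 := by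
  have := γ_pos hn i
  rw [s, norm_smul, norm_inv, Real.norm_of_nonneg this.le, ← γ, inv_mul_cancel₀ this.ne']

theorem w_eq (hn : cross (p 1 - p 0) (p 2 - p 0) ≠ 0) :
    w p = ‖cross (p 1 - p 0) (p 2 - p 0)‖⁻¹ • cross (p 1 - p 0) (p 2 - p 0) := by
  have h : cross (s p 0) (s p 1)
      = ((γ p 0)⁻¹ * (γ p 1)⁻¹) • cross (p 1 - p 0) (p 2 - p 0) := by
    rw [s, s, cross_smul_left, cross_smul_right, smul_smul, ← cross_edges]; rfl
  have h0 := γ_pos hn 0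
  have h1 := γ_pos hn 1
  rw [w, h, norm_smul, Real.norm_of_nonneg (by positivity), smul_smul]
  congr 1
  have := norm_pos_iff.2 hn
  field_simp

theorem norm_w (hn : cross (p 1 - p 0) (p 2 - p 0) ≠ 0) : ‖w p‖ = 1 := by
  rw [w_eq hn, norm_smul, norm_inv, norm_norm, inv_mul_cancel₀ (norm_pos_iff.2 hn).ne']

theorem inner_w_edge (hn : cross (p 1 - p 0) (p 2 - p 0) ≠ 0) (i j : Fin 3) :
    ⟪w p, p i - p j⟫ = 0 := by
  have h : ∀ k, ⟪w p, p k - p 0⟫ = 0 := fun k => by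
    rw [w_eq hn, inner_smul_left]
    fin_cases k <;> simp [inner_cross_left, inner_cross_right]
  rw [← sub_sub_sub_cancel_right (p i) (p j) (p 0), inner_sub_right, h, h, sub_self]

theorem inner_w_s (hn : cross (p 1 - p 0) (p 2 - p 0) ≠ 0) (i : Fin 3) : ⟪w p, s p i⟫ = 0 := by
  rw [s, inner_smul_right, inner_w_edge hn, mul_zero]

/-- The orthonormal frame spanned by two orthogonal unit vectors. -/
theorem eq_frame_sum {s w : E3} (hs : ‖s‖ = 1) (hw : ‖w‖ = 1) (hws : ⟪w, s⟫ = 0) (x : E3) :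
    x = ⟪s, x⟫ • s + ⟪cross s w, x⟫ • cross s w + ⟪w, x⟫ • w := by
  have hmm : ‖cross s w‖ ^ 2 = 1 := by
    rw [norm_sq_cross, hs, hw, real_inner_comm, hws]; norm_num
  -- With `m = s × w`, the vector `m × (m × x)` is expanded in two ways; comparing them expresses
  -- `x` in the frame.
  have h1 := cross_cross_right (cross s w) (cross s w) x
  have h2 : cross (cross s w) (cross (cross s w) x) = -⟪s, x⟫ • s - ⟪w, x⟫ • w := by
    rw [cross_cross_left s w x, cross_cross_left, inner_sub_right, inner_sub_right]
    simp only [inner_smul_right, real_inner_self_eq_norm_sq, hs, hw, hws, real_inner_comm w s]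
    module
  rw [h2, real_inner_self_eq_norm_sq, hmm, one_smul] at h1
  rw [eq_sub_iff_add_eq] at h1
  rw [← h1]
  module

theorem inner_frame {s w : E3} (hs : ‖s‖ = 1) (hw : ‖w‖ = 1) (hws : ⟪w, s⟫ = 0) {x y : E3}
    (hx : ⟪w, x⟫ = 0) : ⟪x, y⟫ = ⟪x, s⟫ * ⟪s, y⟫ + ⟪x, cross s w⟫ * ⟪cross s w, y⟫ := by
  conv_lhs => rw [eq_frame_sum hs hw hws x]
  rw [hx]
  simp only [inner_add_left, inner_smul_left, real_inner_comm x, conj_trivial, zero_smul, add_zero]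

theorem inner_w_u (hn : cross (p 1 - p 0) (p 2 - p 0) ≠ 0) : ⟪w p, u p⟫ = 0 := inner_w_s hn 2

theorem inner_w_v : ⟪w p, v p⟫ = 0 := by rw [v, real_inner_comm, inner_cross_left]

theorem inner_w_m (i : Fin 3) : ⟪w p, m p i⟫ = 0 := by rw [m, real_inner_comm, inner_cross_right]

theorem inner_s_m (i : Fin 3) : ⟪s p i, m p i⟫ = 0 := by rw [m, real_inner_comm, inner_cross_left]

theorem inner_u_v : ⟪u p, v p⟫ = 0 := by rw [v, real_inner_comm, inner_cross_right]

theorem norm_u (hn : cross (p 1 - p 0) (p 2 - p 0) ≠ 0) : ‖u p‖ = 1 := norm_s hn 2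

theorem norm_v (hn : cross (p 1 - p 0) (p 2 - p 0) ≠ 0) : ‖v p‖ = 1 := by
  rw [← sq_eq_sq₀ (norm_nonneg _) zero_le_one, v, norm_sq_cross, norm_w hn, norm_u hn,
    inner_w_u hn]
  norm_num

theorem norm_m (hn : cross (p 1 - p 0) (p 2 - p 0) ≠ 0) (i : Fin 3) : ‖m p i‖ = 1 := by
  rw [← sq_eq_sq₀ (norm_nonneg _) zero_le_one, m, norm_sq_cross, norm_w hn, norm_s hn,
    real_inner_comm, inner_w_s hn]
  norm_num

theorem v_eq (p : Fin 3 → E3) : v p = -cross (u p) (w p) := by rw [v, cross_swap]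

theorem eq_uvw (hn : cross (p 1 - p 0) (p 2 - p 0) ≠ 0) (x : E3) :
    x = ⟪u p, x⟫ • u p + ⟪v p, x⟫ • v p + ⟪w p, x⟫ • w p := by
  conv_lhs => rw [eq_frame_sum (norm_u hn) (norm_w hn) (inner_w_u hn) x]
  rw [v_eq, inner_neg_left]
  module

theorem inner_uv (hn : cross (p 1 - p 0) (p 2 - p 0) ≠ 0) {x y : E3} (hx : ⟪w p, x⟫ = 0) :
    ⟪x, y⟫ = ⟪x, u p⟫ * ⟪u p, y⟫ + ⟪x, v p⟫ * ⟪v p, y⟫ := by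
  rw [inner_frame (norm_u hn) (norm_w hn) (inner_w_u hn) hx, v_eq, inner_neg_left,
    inner_neg_right]
  ring

theorem inner_sm (hn : cross (p 1 - p 0) (p 2 - p 0) ≠ 0) (i : Fin 3) {x y : E3}
    (hx : ⟪w p, x⟫ = 0) :
    ⟪x, y⟫ = ⟪x, s p i⟫ * ⟪s p i, y⟫ + ⟪x, m p i⟫ * ⟪m p i, y⟫ :=
  inner_frame (norm_s hn i) (norm_w hn) (inner_w_s hn i) hx

theorem edge_two (hn : cross (p 1 - p 0) (p 2 - p 0) ≠ 0) : p 1 - p 0 = γ p 2 • u p :=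
  (γ_smul_s hn 2).symm

theorem edge_one (hn : cross (p 1 - p 0) (p 2 - p 0) ≠ 0) :
    p 2 - p 0 = u3 p • u p + v3 p • v p := by
  conv_lhs => rw [eq_uvw hn (p 2 - p 0), inner_w_edge hn, zero_smul, add_zero]
  rfl

/-- Twice the area is base times height. In particular the height `v3` is positive. -/
theorem norm_cross_eq (hn : cross (p 1 - p 0) (p 2 - p 0) ≠ 0) :
    ‖cross (p 1 - p 0) (p 2 - p 0)‖ = γ p 2 * v3 p := by
  have h : ⟪w p, cross (p 1 - p 0) (p 2 - p 0)⟫ = ‖cross (p 1 - p 0) (p 2 - p 0)‖ := by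
    rw [w_eq hn, inner_smul_left, real_inner_self_eq_norm_sq]
    have := norm_pos_iff.2 hn
    simp; field_simp
  rw [← h, edge_two hn, cross_smul_left, inner_smul_right, v3, v, inner_cross_cyclic,
    real_inner_comm]

theorem v3_pos (hn : cross (p 1 - p 0) (p 2 - p 0) ≠ 0) : 0 < v3 p := by
  have := norm_cross_eq hn ▸ norm_pos_iff.2 hn
  exact pos_of_mul_pos_right this (γ_pos hn 2).le

theorem s_zero (hn : cross (p 1 - p 0) (p 2 - p 0) ≠ 0) :
    γ p 0 • s p 0 = (u3 p - γ p 2) • u p + v3 p • v p := by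
  have : p 2 - p 1 = (p 2 - p 0) - (p 1 - p 0) := by abel
  rw [γ_smul_s hn, show (0 : Fin 3) + 2 = 2 from rfl, show (0 : Fin 3) + 1 = 1 from rfl, this,
    edge_one hn, edge_two hn]
  module

theorem s_one (hn : cross (p 1 - p 0) (p 2 - p 0) ≠ 0) :
    γ p 1 • s p 1 = -(u3 p) • u p - v3 p • v p := by
  have : p 0 - p 2 = -(p 2 - p 0) := by abel
  rw [γ_smul_s hn, show (1 : Fin 3) + 2 = 0 from rfl, show (1 : Fin 3) + 1 = 2 from rfl, this,
    edge_one hn]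
  module

theorem cross_v_w (hn : cross (p 1 - p 0) (p 2 - p 0) ≠ 0) : cross (v p) (w p) = u p := by
  rw [v, cross_cross_left, real_inner_self_eq_norm_sq, norm_w hn, real_inner_comm, inner_w_u hn]
  simp

theorem m_two : m p 2 = -v p := by rw [v_eq, neg_neg]; rfl

theorem m_zero (hn : cross (p 1 - p 0) (p 2 - p 0) ≠ 0) :
    γ p 0 • m p 0 = v3 p • u p - (u3 p - γ p 2) • v p := by
  rw [m, ← cross_smul_left, s_zero hn, cross_add_left, cross_smul_left, cross_smul_left,
    cross_v_w hn, ← neg_neg (cross (u p) (w p)), ← v_eq]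
  module

theorem m_one (hn : cross (p 1 - p 0) (p 2 - p 0) ≠ 0) :
    γ p 1 • m p 1 = u3 p • v p - v3 p • u p := by
  rw [m, ← cross_smul_left, s_one hn, sub_eq_add_neg, ← neg_smul, cross_add_left, cross_smul_left,
    cross_smul_left, cross_v_w hn, ← neg_neg (cross (u p) (w p)), ← v_eq]
  module

theorem inner_w_vertex (hn : cross (p 1 - p 0) (p 2 - p 0) ≠ 0) (i : Fin 3) :
    ⟪w p, p i - x₀⟫ = w0 p x₀ := by
  have : p i - x₀ = (p i - p 0) - (x₀ - p 0) := by abel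
  rw [this, inner_sub_right, inner_w_edge hn, w0, zero_sub]

theorem inner_u_vertex (hn : cross (p 1 - p 0) (p 2 - p 0) ≠ 0) (i : Fin 3) :
    ⟪u p, p i - x₀⟫ = ![-u0 p x₀, γ p 2 - u0 p x₀, u3 p - u0 p x₀] i := by
  have : p i - x₀ = (p i - p 0) - (x₀ - p 0) := by abel
  rw [this, inner_sub_right]
  change ⟪u p, p i - p 0⟫ - u0 p x₀ = _
  fin_cases i
  · simp
  · simp [edge_two hn, inner_smul_right, norm_u hn]
  · simp [u3]

theorem inner_v_vertex (hn : cross (p 1 - p 0) (p 2 - p 0) ≠ 0) (i : Fin 3) :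
    ⟪v p, p i - x₀⟫ = ![-v0 p x₀, -v0 p x₀, v3 p - v0 p x₀] i := by
  have : p i - x₀ = (p i - p 0) - (x₀ - p 0) := by abel
  rw [this, inner_sub_right]
  change ⟪v p, p i - p 0⟫ - v0 p x₀ = _
  fin_cases i
  · simp
  · simp [edge_two hn, inner_smul_right, real_inner_comm (u p) (v p), inner_u_v]
  · simp [v3]

/-- Geometric meaning of the coordinate formula: the signed in-plane distance from `x₀` to the line
of edge `i`. The division in `m p i` is cleared by multiplying with the edge length. -/
theorem t_eq (hn : cross (p 1 - p 0) (p 2 - p 0) ≠ 0) (i : Fin 3) :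
    t p x₀ i = ⟪m p i, p (i + 1) - x₀⟫ := by
  have h0 := (γ_pos hn 0).ne'
  have h1 := (γ_pos hn 1).ne'
  have hu := inner_u_vertex (x₀ := x₀) hn
  have hv := inner_v_vertex (x₀ := x₀) hn
  fin_cases i
  · refine mul_left_cancel₀ h0 (Eq.trans ?_ (real_inner_smul_left _ _ _))
    simp only [Fin.zero_eta]
    rw [m_zero hn, inner_sub_left, inner_smul_left, inner_smul_left, hu, hv]
    simp [t]; field_simp; ring
  · refine mul_left_cancel₀ h1 (Eq.trans ?_ (real_inner_smul_left _ _ _))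
    simp only [Fin.mk_one]
    rw [m_one hn, inner_sub_left, inner_smul_left, inner_smul_left, hu, hv]
    simp [t]; field_simp; ring
  · simp only [Fin.reduceFinMk]
    rw [m_two, inner_neg_left, hv]
    simp [t]

theorem γminus_eq (hn : cross (p 1 - p 0) (p 2 - p 0) ≠ 0) (i : Fin 3) :
    γminus p x₀ i = ⟪s p i, p (i + 1) - x₀⟫ := by
  have h0 := (γ_pos hn 0).ne'
  have h1 := (γ_pos hn 1).ne'
  have hu := inner_u_vertex (x₀ := x₀) hn
  have hv := inner_v_vertex (x₀ := x₀) hn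
  fin_cases i
  · refine mul_left_cancel₀ h0 (Eq.trans ?_ (real_inner_smul_left _ _ _))
    simp only [Fin.zero_eta]
    rw [s_zero hn, inner_add_left, inner_smul_left, inner_smul_left, hu, hv]
    simp [γminus]; field_simp; ring
  · refine mul_left_cancel₀ h1 (Eq.trans ?_ (real_inner_smul_left _ _ _))
    simp only [Fin.mk_one]
    rw [s_one hn, inner_sub_left, inner_smul_left, inner_smul_left, hu, hv]
    simp [γminus]; field_simp; ring
  · simp only [Fin.reduceFinMk]
    rw [← u, hu]
    simp [γminus]

/-- Together with `γminus_eq`, this shows that the arc-length coordinate on edge `i`, measured from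
the projection of `x₀`, runs from `γminus` to `γplus`. -/
theorem γplus_eq (hn : cross (p 1 - p 0) (p 2 - p 0) ≠ 0) (i : Fin 3) :
    γplus p x₀ i = γminus p x₀ i + γ p i := by
  have h : γ p i = ⟪s p i, p (i + 2) - p (i + 1)⟫ := by
    rw [← γ_smul_s hn, inner_smul_right, real_inner_self_eq_norm_sq, norm_s hn]; norm_num
  have h0 := (γ_pos hn 0).ne'
  have h1 := (γ_pos hn 1).ne'
  have hu := inner_u_vertex (x₀ := x₀) hn
  have hv := inner_v_vertex (x₀ := x₀) hn
  rw [γminus_eq hn, h, ← inner_add_right, add_comm, sub_add_sub_cancel]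
  fin_cases i
  · refine mul_left_cancel₀ h0 (Eq.trans ?_ (real_inner_smul_left _ _ _))
    simp only [Fin.zero_eta]
    rw [s_zero hn, inner_add_left, inner_smul_left, inner_smul_left, hu, hv]
    simp [γplus]; field_simp
  · refine mul_left_cancel₀ h1 (Eq.trans ?_ (real_inner_smul_left _ _ _))
    simp only [Fin.mk_one]
    rw [s_one hn, inner_sub_left, inner_smul_left, inner_smul_left, hu, hv]
    simp [γplus]; field_simp
  · simp only [Fin.reduceFinMk]
    rw [← u, hu]
    simp [γplus]

end Tri

/-! ### Gradient theorem on a triangle in space, and linearity of face and edge integrals. -/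

section FaceIntegral

open MeasureTheory Set

variable {p : Fin 3 → E3} {x₀ : E3}

theorem triPt_mem_hull (p : Fin 3 → E3) {q : ℝ × ℝ} (hq : q ∈ stdTri) :
    triPt (p 0) (p 1) (p 2) q ∈ convexHull ℝ (range p) := by
  obtain ⟨h1, h2, h3⟩ := hq
  have : triPt (p 0) (p 1) (p 2) q = ∑ i, (![1 - (q.1 + q.2), q.1, q.2] : Fin 3 → ℝ) i • p i := by
    simp only [triPt, Fin.sum_univ_three, Matrix.cons_val]
    module
  rw [this]
  refine (convex_convexHull ℝ _).sum_mem ?_ ?_ fun i _ => subset_convexHull ℝ _ (mem_range_self i)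
  · intro i _
    fin_cases i <;> simp <;> linarith
  · simp [Fin.sum_univ_three]; ring

theorem segPt_mem_hull (p : Fin 3 → E3) (i j : Fin 3) {r : ℝ} (hr : r ∈ Icc (0 : ℝ) 1) :
    segPt (p i) (p j) r ∈ convexHull ℝ (range p) :=
  (convex_convexHull ℝ _).add_smul_sub_mem (subset_convexHull ℝ _ (mem_range_self i))
    (subset_convexHull ℝ _ (mem_range_self j)) hr

theorem continuous_segPt {E : Type*} [NormedAddCommGroup E] [NormedSpace ℝ E] (a b : E) :
    Continuous (segPt a b) := by
  unfold segPt; fun_prop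

theorem segInt_symm {E : Type*} [NormedAddCommGroup E] [NormedSpace ℝ E] (a b : E) (h : E → ℝ) :
    segInt b a h = segInt a b h := by
  have := intervalIntegral.integral_comp_sub_left (a := 0) (b := 1) (fun t => h (segPt a b t)) 1
  simp only [sub_self, sub_zero] at this
  rw [segInt, segInt, ← this]
  congr 1
  ext t
  congr 1
  simp only [segPt]
  module

theorem integrableOn_triPt {h : E3 → ℝ} (hh : ContinuousOn h (convexHull ℝ (range p))) :
    IntegrableOn (fun q => h (triPt (p 0) (p 1) (p 2) q)) stdTri :=
  (hh.comp (continuous_triPt _ _ _).continuousOn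
    (fun _ hq => triPt_mem_hull p hq)).integrableOn_compact isCompact_stdTri

theorem faceInt_congr {h k : E3 → ℝ} (hk : ∀ x ∈ convexHull ℝ (range p), h x = k x) :
    faceInt p h = faceInt p k := by
  rw [faceInt, faceInt, triInt, triInt]
  congr 1
  exact setIntegral_congr_fun isClosed_stdTri.measurableSet fun q hq => hk _ (triPt_mem_hull p hq)

theorem faceInt_add {h k : E3 → ℝ} (hh : ContinuousOn h (convexHull ℝ (range p)))
    (hk : ContinuousOn k (convexHull ℝ (range p))) :
    faceInt p (fun x => h x + k x) = faceInt p h + faceInt p k := by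
  rw [faceInt, faceInt, faceInt, triInt, triInt, triInt,
    integral_add (integrableOn_triPt hh) (integrableOn_triPt hk), mul_add]

theorem faceInt_const_mul (c : ℝ) (h : E3 → ℝ) :
    faceInt p (fun x => c * h x) = c * faceInt p h := by
  rw [faceInt, faceInt, triInt, triInt, integral_const_mul]; ring

theorem segInt_congr {i j : Fin 3} {h k : E3 → ℝ}
    (hk : ∀ r ∈ Icc (0 : ℝ) 1, h (segPt (p i) (p j) r) = k (segPt (p i) (p j) r)) :
    segInt (p i) (p j) h = segInt (p i) (p j) k :=
  intervalIntegral.integral_congr fun r hr => hk r (by rwa [uIcc_of_le zero_le_one] at hr)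

theorem segInt_add {i j : Fin 3} {h k : E3 → ℝ} (hh : ContinuousOn h (convexHull ℝ (range p)))
    (hk : ContinuousOn k (convexHull ℝ (range p))) :
    segInt (p i) (p j) (fun x => h x + k x) = segInt (p i) (p j) h + segInt (p i) (p j) k := by
  have : ∀ {h : E3 → ℝ}, ContinuousOn h (convexHull ℝ (range p)) →
      IntervalIntegrable (fun t => h (segPt (p i) (p j) t)) volume 0 1 := fun hh => by
    refine (hh.comp (continuous_segPt (p i) (p j)).continuousOn fun r hr => ?_).intervalIntegrable
    rw [uIcc_of_le zero_le_one] at hr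
    exact segPt_mem_hull p i j hr
  rw [segInt, segInt, segInt, intervalIntegral.integral_add (this hh) (this hk)]

theorem segInt_const_mul (a b : E3) (c : ℝ) (h : E3 → ℝ) :
    segInt a b (fun x => c * h x) = c * segInt a b h := by
  rw [segInt, segInt, intervalIntegral.integral_const_mul]

namespace Tri

theorem inner_w_hull (hn : cross (p 1 - p 0) (p 2 - p 0) ≠ 0) {x : E3}
    (hx : x ∈ convexHull ℝ (range p)) : ⟪w p, x - x₀⟫ = w0 p x₀ := by
  have hsub : convexHull ℝ (range p) ⊆ {x | ⟪w p, x - x₀⟫ = w0 p x₀} := by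
    refine convexHull_min ?_ fun x hx y hy a b _ _ hab => ?_
    · rintro _ ⟨i, rfl⟩
      exact inner_w_vertex hn i
    · simp only [mem_ofPred_eq, inner_sub_right, inner_add_right, inner_smul_right] at *
      linear_combination a * hx + b * hy + (⟪w p, x₀⟫ + w0 p x₀) * hab
  exact hsub hx

/-- The gradient theorem on a triangle. -/
theorem faceInt_fderiv (hn : cross (p 1 - p 0) (p 2 - p 0) ≠ 0) {g : E3 → ℝ}
    (hg : ∀ x ∈ convexHull ℝ (range p), ContDiffAt ℝ 1 g x) {d : E3} (hd : ⟪w p, d⟫ = 0) :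
    faceInt p (fun x => fderiv ℝ g x d) =
      ∑ i, ⟪m p i, d⟫ * (γ p i * segInt (p (i + 1)) (p (i + 2)) g) := by
  have h1 : faceInt p (fun x => fderiv ℝ g x (p 1 - p 0)) =
      γ p 2 * v3 p * (segInt (p 1) (p 2) g - segInt (p 0) (p 2) g) := by
    rw [faceInt, norm_cross_eq hn, triInt_fderiv fun q hq => hg _ (triPt_mem_hull p hq)]
  -- The second edge direction is reduced to the first by exchanging `p 1` and `p 2`.
  have h2 : faceInt p (fun x => fderiv ℝ g x (p 2 - p 0)) =
      γ p 2 * v3 p * (segInt (p 1) (p 2) g - segInt (p 0) (p 1) g) := by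
    rw [faceInt, norm_cross_eq hn, ← triInt_swap_right, triInt_fderiv, segInt_symm (p 1)]
    intro q hq
    have : triPt (p 0) (p 2) (p 1) q = triPt (p 0) (p 1) (p 2) q.swap := by
      simp only [triPt, Prod.swap]; abel
    rw [this]
    exact hg _ (triPt_mem_hull p ⟨hq.2.1, hq.1, by simpa [add_comm] using hq.2.2⟩)
  have hγ := γ_pos hn
  have hv := v3_pos hn
  -- Coordinates of `d` along the edges at `p 0`. Only the edge to `p 2` has a `v`-component, which
  -- determines `β'` and then `α'`.
  set β' := ⟪v p, d⟫ / v3 p with hβ'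
  set α' := (⟪u p, d⟫ - β' * u3 p) / γ p 2 with hα'
  have hud : ⟪u p, d⟫ = α' * γ p 2 + β' * u3 p := by
    have := hγ 2
    rw [hα']; field_simp; ring
  have hvd : ⟪v p, d⟫ = β' * v3 p := by rw [hβ']; field_simp
  have hd' : d = α' • (p 1 - p 0) + β' • (p 2 - p 0) := by
    conv_lhs => rw [eq_uvw hn d, hd, hud, hvd]
    rw [edge_two hn, edge_one hn]
    module
  have hm : ∀ i, γ p i * ⟪m p i, d⟫ = ⟪γ p i • m p i, d⟫ := fun i =>
    (real_inner_smul_left _ _ _).symm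
  have hm0 : γ p 0 * ⟪m p 0, d⟫ = v3 p * ⟪u p, d⟫ - (u3 p - γ p 2) * ⟪v p, d⟫ := by
    rw [hm, m_zero hn, inner_sub_left, real_inner_smul_left, real_inner_smul_left]
  have hm1 : γ p 1 * ⟪m p 1, d⟫ = u3 p * ⟪v p, d⟫ - v3 p * ⟪u p, d⟫ := by
    rw [hm, m_one hn, inner_sub_left, real_inner_smul_left, real_inner_smul_left]
  have hm2 : ⟪m p 2, d⟫ = -⟪v p, d⟫ := by rw [m_two, inner_neg_left]
  rw [hud, hvd] at hm0 hm1
  rw [hvd] at hm2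
  have hs : faceInt p (fun x => fderiv ℝ g x d) =
      α' * faceInt p (fun x => fderiv ℝ g x (p 1 - p 0))
        + β' * faceInt p (fun x => fderiv ℝ g x (p 2 - p 0)) := by
    rw [← faceInt_const_mul, ← faceInt_const_mul, ← faceInt_add]
    · conv_lhs => rw [hd']
      simp only [map_add, map_smul, smul_eq_mul]
    · exact continuousOn_const.mul (continuousOn_fderiv_apply hg _)
    · exact continuousOn_const.mul (continuousOn_fderiv_apply hg _)
  rw [hs, h1, h2, Fin.sum_univ_three]
  simp only [show (0 : Fin 3) + 1 = 1 from rfl, show (0 : Fin 3) + 2 = 2 from rfl,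
    show (1 : Fin 3) + 1 = 2 from rfl, show (1 : Fin 3) + 2 = 0 from rfl,
    show (2 : Fin 3) + 1 = 0 from rfl, show (2 : Fin 3) + 2 = 1 from rfl]
  rw [segInt_symm (p 0) (p 2)]
  linear_combination (-segInt (p 1) (p 2) g) * hm0 - segInt (p 0) (p 2) g * hm1
    - γ p 2 * segInt (p 0) (p 1) g * hm2

/-! ### Closed forms of the edge integrals. -/

section Edge

theorem segPt_sub (hn : cross (p 1 - p 0) (p 2 - p 0) ≠ 0) (i : Fin 3) (r : ℝ) :
    segPt (p (i + 1)) (p (i + 2)) r - x₀ = (p (i + 1) - x₀) + (γ p i * r) • s p i := by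
  rw [segPt, ← γ_smul_s hn]
  module

theorem inner_s_segPt (hn : cross (p 1 - p 0) (p 2 - p 0) ≠ 0) (i : Fin 3) (r : ℝ) :
    ⟪s p i, segPt (p (i + 1)) (p (i + 2)) r - x₀⟫ = γminus p x₀ i + γ p i * r := by
  rw [segPt_sub hn, inner_add_right, inner_smul_right, real_inner_self_eq_norm_sq, norm_s hn,
    γminus_eq hn]
  ring

theorem inner_m_segPt (hn : cross (p 1 - p 0) (p 2 - p 0) ≠ 0) (i : Fin 3) (r : ℝ) :
    ⟪m p i, segPt (p (i + 1)) (p (i + 2)) r - x₀⟫ = t p x₀ i := by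
  rw [segPt_sub hn, inner_add_right, inner_smul_right, real_inner_comm (s p i), inner_s_m,
    t_eq hn, mul_zero, add_zero]

theorem inner_w_segPt (hn : cross (p 1 - p 0) (p 2 - p 0) ≠ 0) (i : Fin 3) (r : ℝ) :
    ⟪w p, segPt (p (i + 1)) (p (i + 2)) r - x₀⟫ = w0 p x₀ := by
  rw [segPt_sub hn, inner_add_right, inner_smul_right, inner_w_s hn, inner_w_vertex hn, mul_zero,
    add_zero]

theorem norm_segPt (hn : cross (p 1 - p 0) (p 2 - p 0) ≠ 0) (i : Fin 3) (r : ℝ) :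
    ‖segPt (p (i + 1)) (p (i + 2)) r - x₀‖ =
      √(t p x₀ i ^ 2 + w0 p x₀ ^ 2 + (γminus p x₀ i + γ p i * r) ^ 2) := by
  refine (Real.sqrt_eq_iff_mul_self_eq ?_ (norm_nonneg _)).2 ?_ |>.symm
  · positivity
  · rw [← real_inner_self_eq_norm_mul_norm]
    conv_rhs => rw [eq_frame_sum (norm_s hn i) (norm_w hn) (inner_w_s hn i)
      (segPt (p (i + 1)) (p (i + 2)) r - x₀), ← m, inner_s_segPt hn, inner_m_segPt hn,
      inner_w_segPt hn]
    simp only [inner_add_left, inner_add_right, inner_smul_left, inner_smul_right,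
      real_inner_self_eq_norm_sq, norm_s hn, norm_m hn, norm_w hn, inner_w_s hn, inner_w_m,
      inner_s_m, real_inner_comm (s p i), real_inner_comm (w p), conj_trivial]
    ring

theorem edge_pos (hn : cross (p 1 - p 0) (p 2 - p 0) ≠ 0) (hx : x₀ ∉ convexHull ℝ (range p))
    (i : Fin 3) : ∀ l ∈ Icc (γminus p x₀ i) (γplus p x₀ i),
      0 < t p x₀ i ^ 2 + w0 p x₀ ^ 2 + l ^ 2 := by
  intro l hl
  have hγ := γ_pos hn i
  rw [γplus_eq hn] at hl
  have hr : (l - γminus p x₀ i) / γ p i ∈ Icc (0 : ℝ) 1 :=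
    ⟨div_nonneg (by linarith [hl.1]) hγ.le, (div_le_one hγ).2 (by linarith [hl.2])⟩
  have hne : segPt (p (i + 1)) (p (i + 2)) ((l - γminus p x₀ i) / γ p i) - x₀ ≠ 0 :=
    sub_ne_zero.2 fun h => hx (h ▸ segPt_mem_hull p _ _ hr)
  have := norm_pos_iff.2 hne
  rw [norm_segPt hn, mul_div_cancel₀ _ hγ.ne', add_sub_cancel] at this
  exact Real.sqrt_pos.1 this

/-- Substitution of the arc-length coordinate `l = γminus + γ r`, followed by the fundamental
theorem of calculus. The factor `γ p i` turns the mean over the edge into its line integral. -/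
theorem γ_mul_segInt (hn : cross (p 1 - p 0) (p 2 - p 0) ≠ 0) {i : Fin 3} {g : E3 → ℝ}
    {k H : ℝ → ℝ} (hH : ∀ l ∈ Icc (γminus p x₀ i) (γplus p x₀ i), HasDerivAt H (k l) l)
    (hk : ContinuousOn k (Icc (γminus p x₀ i) (γplus p x₀ i)))
    (hg : ∀ r, g (segPt (p (i + 1)) (p (i + 2)) r) = k (γminus p x₀ i + γ p i * r)) :
    γ p i * segInt (p (i + 1)) (p (i + 2)) g = H (γplus p x₀ i) - H (γminus p x₀ i) := by
  have hle : γminus p x₀ i ≤ γplus p x₀ i := by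
    rw [γplus_eq hn]; linarith [γ_pos hn i]
  simp only [segInt, hg]
  rw [intervalIntegral.mul_integral_comp_add_mul, mul_zero, add_zero, mul_one, ← γplus_eq hn,
    intervalIntegral.integral_eq_sub_of_hasDerivAt (by rwa [uIcc_of_le hle])
      (ContinuousOn.intervalIntegrable (by rwa [uIcc_of_le hle]))]

theorem continuousOn_sqrt_inv {c : ℝ} {S : Set ℝ} (h : ∀ l ∈ S, 0 < c + l ^ 2) :
    ContinuousOn (fun l => (√(c + l ^ 2))⁻¹) S :=
  ContinuousOn.inv₀ (by fun_prop) fun l hl => (Real.sqrt_pos.2 (h l hl)).ne'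

/-- `log (r + l)` and `-log (r - l)` are both primitives of `1 / r`. The sign of `γminus` selects
one whose argument stays positive along the whole edge, even if `x₀` lies on its line. -/
theorem γ_mul_segInt_inv_norm (hn : cross (p 1 - p 0) (p 2 - p 0) ≠ 0)
    (hx : x₀ ∉ convexHull ℝ (range p)) (i : Fin 3) :
    γ p i * segInt (p (i + 1)) (p (i + 2)) (fun x => ‖x - x₀‖⁻¹) = f p x₀ i := by
  have hpos := edge_pos hn hx i
  have hle : γminus p x₀ i ≤ γplus p x₀ i := by
    rw [γplus_eq hn]; linarith [γ_pos hn i]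
  have hg : ∀ r, ‖segPt (p (i + 1)) (p (i + 2)) r - x₀‖⁻¹ =
      (√(t p x₀ i ^ 2 + w0 p x₀ ^ 2 + (γminus p x₀ i + γ p i * r) ^ 2))⁻¹ := fun r => by
    rw [norm_segPt hn]
  have hc : 0 ≤ t p x₀ i ^ 2 + w0 p x₀ ^ 2 := by positivity
  rw [f, Rplus, Rminus]
  split_ifs with h
  · have hp : ∀ l ∈ Icc (γminus p x₀ i) (γplus p x₀ i),
        0 < √(t p x₀ i ^ 2 + w0 p x₀ ^ 2 + l ^ 2) + l := fun l hl =>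
      add_sqrt_pos (h.trans hl.1) (hpos l hl)
    rw [Real.log_div (hp _ (right_mem_Icc.2 hle)).ne' (hp _ (left_mem_Icc.2 hle)).ne']
    exact γ_mul_segInt hn (fun l hl => hasDerivAt_log_sqrt_add (hpos l hl) (hp l hl))
      (continuousOn_sqrt_inv hpos) hg
  · have hp : ∀ l ∈ Icc (γminus p x₀ i) (γplus p x₀ i),
        0 < √(t p x₀ i ^ 2 + w0 p x₀ ^ 2 + l ^ 2) - l := fun l hl =>
      sqrt_sub_pos hc _ (not_le.1 h) hl hpos
    rw [Real.log_div (hp _ (left_mem_Icc.2 hle)).ne' (hp _ (right_mem_Icc.2 hle)).ne']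
    refine (γ_mul_segInt hn (fun l hl => hasDerivAt_neg_log_sqrt_sub (hpos l hl) (hp l hl))
      (continuousOn_sqrt_inv hpos) hg).trans ?_
    ring

theorem γ_mul_segInt_inner_s (hn : cross (p 1 - p 0) (p 2 - p 0) ≠ 0)
    (hx : x₀ ∉ convexHull ℝ (range p)) (i : Fin 3) :
    γ p i * segInt (p (i + 1)) (p (i + 2)) (fun x => ⟪s p i, x - x₀⟫ * ‖x - x₀‖⁻¹) =
      Rplus p x₀ i - Rminus p x₀ i :=
  γ_mul_segInt hn (fun l hl => hasDerivAt_sqrt_add_sq (edge_pos hn hx i l hl))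
    (continuousOn_id.mul (continuousOn_sqrt_inv (edge_pos hn hx i)))
    fun r => by simp only [inner_s_segPt hn, norm_segPt hn]; rfl

/-- On the edge `⟪m p i, x - x₀⟫` is the constant `t p x₀ i`, so the arctangent is a primitive. The
assumption `w0 ≠ 0` keeps its denominator positive when `t p x₀ i = 0`. -/
theorem γ_mul_segInt_inner_m (hn : cross (p 1 - p 0) (p 2 - p 0) ≠ 0) (hw : w0 p x₀ ≠ 0)
    (i : Fin 3) :
    γ p i * segInt (p (i + 1)) (p (i + 2))
      (fun x => ⟪m p i, x - x₀⟫ * (‖x - x₀‖ * (‖x - x₀‖ + |w0 p x₀|))⁻¹) = βi p x₀ i := by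
  have hW := abs_pos.2 hw
  have hc : 0 < t p x₀ i ^ 2 + |w0 p x₀| ^ 2 := by positivity
  have hR : R p x₀ i ^ 2 = t p x₀ i ^ 2 + |w0 p x₀| ^ 2 := by
    rw [R, Real.sq_sqrt (by positivity), sq_abs]
  rw [βi, hR, Rplus, Rminus, ← sq_abs (w0 p x₀)]
  refine γ_mul_segInt hn (fun l hl => hasDerivAt_arctan_solid_angle hW.le hc) ?_ fun r => ?_
  · refine continuousOn_const.mul (ContinuousOn.inv₀ (by fun_prop) fun l hl => ?_)
    have := Real.sqrt_pos.2 (show 0 < t p x₀ i ^ 2 + |w0 p x₀| ^ 2 + l ^ 2 by positivity)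
    positivity
  · rw [inner_m_segPt hn, norm_segPt hn, sq_abs]

end Edge

end Tri

end FaceIntegral

/-! ### Derivatives of radial functions and of their products with linear functions. -/

section Radial

variable {F : Type*} [NormedAddCommGroup F] [InnerProductSpace ℝ F]

theorem hasFDerivAt_radial {k : ℝ → ℝ} {k' : ℝ} {x x₀ : F} (hx : x ≠ x₀)
    (hk : HasDerivAt k k' ‖x - x₀‖) :
    HasFDerivAt (fun x => k ‖x - x₀‖) ((k' * ‖x - x₀‖⁻¹) • innerSL ℝ (x - x₀)) x := by
  have h0 : ‖x - x₀‖ ≠ 0 := norm_ne_zero_iff.2 (sub_ne_zero.2 hx)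
  have h1 : HasFDerivAt (fun x : F => ‖x - x₀‖ ^ 2) (2 • innerSL ℝ (x - x₀)) x := by
    convert! ((hasFDerivAt_id x).sub_const x₀).norm_sq using 1
  have h2 := h1.sqrt (pow_ne_zero 2 h0)
  simp only [Real.sqrt_sq (norm_nonneg _)] at h2
  convert! hk.comp_hasFDerivAt x h2 using 1
  ext y
  simp
  field_simp

theorem contDiffAt_radial {k : ℝ → ℝ} {x x₀ : F} (hx : x ≠ x₀) (hk : ContDiffAt ℝ 1 k ‖x - x₀‖) :
    ContDiffAt ℝ 1 (fun x => k ‖x - x₀‖) x :=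
  hk.comp x ((contDiffAt_id.sub contDiffAt_const).norm ℝ (sub_ne_zero.2 hx))

theorem fderiv_radial_apply {k : ℝ → ℝ} {k' : ℝ} {x x₀ : F} (hx : x ≠ x₀)
    (hk : HasDerivAt k k' ‖x - x₀‖) (d : F) :
    fderiv ℝ (fun x => k ‖x - x₀‖) x d = k' * ‖x - x₀‖⁻¹ * ⟪d, x - x₀⟫ := by
  rw [(hasFDerivAt_radial hx hk).fderiv, smul_apply, innerSL_apply_apply,
    real_inner_comm, smul_eq_mul]

theorem fderiv_inner_mul_radial_apply {k : ℝ → ℝ} {k' : ℝ} {x x₀ : F} (hx : x ≠ x₀)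
    (hk : HasDerivAt k k' ‖x - x₀‖) (e d : F) :
    fderiv ℝ (fun x => ⟪e, x - x₀⟫ * k ‖x - x₀‖) x d =
      ⟪e, d⟫ * k ‖x - x₀‖ + k' * ‖x - x₀‖⁻¹ * (⟪e, x - x₀⟫ * ⟪d, x - x₀⟫) := by
  have h1 : HasFDerivAt (fun x => ⟪e, x - x₀⟫) (innerSL ℝ e) x :=
    (innerSL ℝ e).hasFDerivAt.comp x ((hasFDerivAt_id x).sub_const x₀)
  have h2 : HasFDerivAt (fun x => ⟪e, x - x₀⟫ * k ‖x - x₀‖) _ x :=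
    h1.mul (hasFDerivAt_radial hx hk)
  rw [h2.fderiv]
  simp only [add_apply, smul_apply, innerSL_apply_apply,
    smul_eq_mul, real_inner_comm d (x - x₀)]
  ring

theorem contDiffAt_inner_mul_radial {k : ℝ → ℝ} {x x₀ : F} (hx : x ≠ x₀)
    (hk : ContDiffAt ℝ 1 k ‖x - x₀‖) (e : F) :
    ContDiffAt ℝ 1 (fun x => ⟪e, x - x₀⟫ * k ‖x - x₀‖) x :=
  (contDiffAt_const.inner ℝ (contDiffAt_id.sub contDiffAt_const)).mul (contDiffAt_radial hx hk)

end Radial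

/-! ### Closed forms of the face integrals. -/

section FaceFormulas

open MeasureTheory Set

namespace Tri

variable {p : Fin 3 → E3} {x₀ : E3}

theorem continuousOn_inv_norm_pow {S : Set E3} (hx : x₀ ∉ S) (n : ℕ) :
    ContinuousOn (fun x => (‖x - x₀‖ ^ n)⁻¹) S :=
  ContinuousOn.inv₀ (by fun_prop) fun x h => pow_ne_zero _
    (norm_ne_zero_iff.2 (sub_ne_zero.2 fun he => hx (he ▸ h)))

theorem norm_pos_of_mem {S : Set E3} (hx : x₀ ∉ S) {x : E3} (h : x ∈ S) : 0 < ‖x - x₀‖ :=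
  norm_pos_iff.2 (sub_ne_zero.2 fun he => hx (he ▸ h))

theorem faceInt_inner_div_cube
    (hn : cross (p 1 - p 0) (p 2 - p 0) ≠ 0) (hx : x₀ ∉ convexHull ℝ (range p))
    {d : E3} (hd : ⟪w p, d⟫ = 0) :
    faceInt p (fun x => ⟪d, x - x₀⟫ * (‖x - x₀‖ ^ 3)⁻¹) = -∑ i, ⟪m p i, d⟫ * f p x₀ i := by
  have hne : ∀ x ∈ convexHull ℝ (range p), x ≠ x₀ := fun x h he => hx (he ▸ h)
  have h := faceInt_fderiv hn (g := fun x => ‖x - x₀‖⁻¹) (fun x h =>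
    contDiffAt_radial (hne x h) (contDiffAt_inv ℝ (norm_pos_of_mem hx h).ne')) hd
  simp only [γ_mul_segInt_inv_norm hn hx] at h
  rw [← h, ← neg_one_mul, ← faceInt_const_mul]
  refine faceInt_congr fun x h => ?_
  have h0 := norm_pos_of_mem hx h
  rw [fderiv_radial_apply (hne x h) (hasDerivAt_inv h0.ne')]
  field_simp

/-- Integrate `∂_d (⟪e, y⟫ r⁻¹)` with `y = x - x₀`. On an edge the tangential vector `e` splits
along `m p i`, where `⟪m p i, y⟫` is constant, and along `s p i`. The integral of `r⁻¹` is still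
unknown here and is eliminated by `faceInt_inv_norm`. -/
theorem faceInt_inner_mul_inner_aux
    (hn : cross (p 1 - p 0) (p 2 - p 0) ≠ 0) (hx : x₀ ∉ convexHull ℝ (range p))
    {d e : E3} (hd : ⟪w p, d⟫ = 0) (he : ⟪w p, e⟫ = 0) :
    ⟪e, d⟫ * faceInt p (fun x => ‖x - x₀‖⁻¹)
        - faceInt p (fun x => ⟪e, x - x₀⟫ * ⟪d, x - x₀⟫ * (‖x - x₀‖ ^ 3)⁻¹) =
      ∑ i, ⟪m p i, d⟫ * (⟪e, m p i⟫ * (t p x₀ i * f p x₀ i)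
        + ⟪e, s p i⟫ * (Rplus p x₀ i - Rminus p x₀ i)) := by
  have hne : ∀ x ∈ convexHull ℝ (range p), x ≠ x₀ := fun x h he => hx (he ▸ h)
  have hc1 : ContinuousOn (fun x => ‖x - x₀‖⁻¹) (convexHull ℝ (range p)) := by
    simpa using continuousOn_inv_norm_pow hx 1
  have h := faceInt_fderiv hn (g := fun x => ⟪e, x - x₀⟫ * ‖x - x₀‖⁻¹) (fun x h =>
    contDiffAt_inner_mul_radial (hne x h) (contDiffAt_inv ℝ (norm_pos_of_mem hx h).ne') e) hd
  have hseg : ∀ i, γ p i * segInt (p (i + 1)) (p (i + 2)) (fun x => ⟪e, x - x₀⟫ * ‖x - x₀‖⁻¹) =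
      ⟪e, m p i⟫ * (t p x₀ i * f p x₀ i)
        + ⟪e, s p i⟫ * (Rplus p x₀ i - Rminus p x₀ i) := fun i => by
    rw [← γ_mul_segInt_inv_norm hn hx, ← γ_mul_segInt_inner_s hn hx,
      segInt_congr (k := fun x => ⟪e, m p i⟫ * t p x₀ i * ‖x - x₀‖⁻¹
        + ⟪e, s p i⟫ * (⟪s p i, x - x₀⟫ * ‖x - x₀‖⁻¹)),
      segInt_add, segInt_const_mul, segInt_const_mul]
    · ring
    · exact continuousOn_const.mul hc1
    · exact continuousOn_const.mul (ContinuousOn.mul (by fun_prop) hc1)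
    · intro r _
      rw [inner_sm hn i he, inner_m_segPt hn]
      ring
  simp only [hseg] at h
  rw [← h, ← faceInt_const_mul, sub_eq_add_neg, ← neg_one_mul (faceInt p _), ← faceInt_const_mul,
    ← faceInt_add]
  · refine faceInt_congr fun x h => ?_
    have h0 := norm_pos_of_mem hx h
    rw [fderiv_inner_mul_radial_apply (hne x h) (hasDerivAt_inv h0.ne')]
    field_simp
  · exact continuousOn_const.mul hc1
  · exact continuousOn_const.mul (ContinuousOn.mul (by fun_prop) (continuousOn_inv_norm_pow hx 3))

/-- The squared tangential component of `x - x₀`. -/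
theorem inner_sq_add_inner_sq (hn : cross (p 1 - p 0) (p 2 - p 0) ≠ 0) {x : E3}
    (hx : x ∈ convexHull ℝ (range p)) :
    ⟪u p, x - x₀⟫ ^ 2 + ⟪v p, x - x₀⟫ ^ 2 = ‖x - x₀‖ ^ 2 - w0 p x₀ ^ 2 := by
  rw [← inner_w_hull hn hx, ← real_inner_self_eq_norm_sq]
  conv_rhs => enter [1, 2]; rw [eq_uvw hn (x - x₀)]
  simp only [inner_add_left, real_inner_smul_left]
  ring

/-- The solid angle formula. -/
theorem faceInt_cube
    (hn : cross (p 1 - p 0) (p 2 - p 0) ≠ 0) (hx : x₀ ∉ convexHull ℝ (range p))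
    (hw : w0 p x₀ ≠ 0) :
    |w0 p x₀| * faceInt p (fun x => (‖x - x₀‖ ^ 3)⁻¹) = β p x₀ := by
  have hne : ∀ x ∈ convexHull ℝ (range p), x ≠ x₀ := fun x h he => hx (he ▸ h)
  set W := |w0 p x₀| with hW
  have hW0 : 0 < W := abs_pos.2 hw
  -- The weight `k(r) = 1 / (r (r + W))` solves `2 k + k' (r² - W²) / r = W / r³`. The left side is
  -- the planar divergence of `k(r)` times the tangential part of `x - x₀`.
  have hk : ∀ r : ℝ, 0 < r → HasDerivAt (fun r => (r * (r + W))⁻¹)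
      (-(2 * r + W) / (r * (r + W)) ^ 2) r := fun r hr => by
    have h1 : HasDerivAt (fun r => r * (r + W)) (2 * r + W) r := by
      convert! (hasDerivAt_id r).mul ((hasDerivAt_id r).add_const W) using 1
      simp only [id]; ring
    exact h1.inv (by positivity)
  have hks : ∀ r : ℝ, 0 < r → ContDiffAt ℝ 1 (fun r => (r * (r + W))⁻¹) r := fun r hr =>
    (contDiffAt_id.mul (contDiffAt_id.add contDiffAt_const)).inv
      (by simp only [id]; positivity)
  have hgs : ∀ e : E3, ∀ x ∈ convexHull ℝ (range p),
      ContDiffAt ℝ 1 (fun x => ⟪e, x - x₀⟫ * (‖x - x₀‖ * (‖x - x₀‖ + W))⁻¹) x := fun e x h =>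
    contDiffAt_inner_mul_radial (hne x h) (hks _ (norm_pos_of_mem hx h)) e
  have hu := faceInt_fderiv hn (hgs (u p)) (inner_w_u hn)
  have hv := faceInt_fderiv hn (hgs (v p)) inner_w_v
  have hadd := congrArg₂ (· + ·) hu hv
  beta_reduce at hadd
  rw [← faceInt_add (continuousOn_fderiv_apply (hgs _) _) (continuousOn_fderiv_apply (hgs _) _),
    ← Finset.sum_add_distrib] at hadd
  rw [← faceInt_const_mul, β]
  refine Eq.trans (faceInt_congr fun x h => ?_) (hadd.trans (Finset.sum_congr rfl fun i _ => ?_))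
  · have h0 := norm_pos_of_mem hx h
    have hsq := inner_sq_add_inner_sq (x₀ := x₀) hn h
    rw [← sq_abs (w0 p x₀), ← hW] at hsq
    rw [fderiv_inner_mul_radial_apply (hne x h) (hk _ h0),
      fderiv_inner_mul_radial_apply (hne x h) (hk _ h0), real_inner_self_eq_norm_sq,
      real_inner_self_eq_norm_sq, norm_u hn, norm_v hn]
    have h1 : 0 < ‖x - x₀‖ + W := by positivity
    field_simp
    linear_combination (2 * ‖x - x₀‖ + W) * hsq
  · have hc : ∀ (c : ℝ) (e : E3), ContinuousOn
        (fun x => c * (⟪e, x - x₀⟫ * (‖x - x₀‖ * (‖x - x₀‖ + W))⁻¹)) (convexHull ℝ (range p)) :=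
      fun c e x h => ((hgs e x h).continuousAt.const_mul c).continuousWithinAt
    -- The `u` and `v` contributions recombine into `⟪m p i, x - x₀⟫` because `m p i` is tangential.
    rw [← γ_mul_segInt_inner_m hn hw, mul_left_comm, mul_left_comm ⟪m p i, v p⟫, ← mul_add,
      ← segInt_const_mul, ← segInt_const_mul, ← segInt_add (hc _ _) (hc _ _)]
    congr 1
    refine segInt_congr fun r _ => ?_
    rw [← hW, inner_uv hn (x := m p i) (y := segPt _ _ r - x₀) (inner_w_m i)]
    ring

/-- Multiplying by `w0` removes the restriction `w0 ≠ 0`: for `w0 = 0` both sides vanish whatever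
the value of `β`. -/
theorem sq_mul_faceInt_cube
    (hn : cross (p 1 - p 0) (p 2 - p 0) ≠ 0) (hx : x₀ ∉ convexHull ℝ (range p)) :
    w0 p x₀ ^ 2 * faceInt p (fun x => (‖x - x₀‖ ^ 3)⁻¹) = |w0 p x₀| * β p x₀ := by
  by_cases hw : w0 p x₀ = 0
  · simp [hw]
  · rw [← faceInt_cube hn hx hw, ← mul_assoc, ← sq, sq_abs]

theorem mul_faceInt_cube
    (hn : cross (p 1 - p 0) (p 2 - p 0) ≠ 0) (hx : x₀ ∉ convexHull ℝ (range p)) :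
    w0 p x₀ * faceInt p (fun x => (‖x - x₀‖ ^ 3)⁻¹) = Real.sign (w0 p x₀) * β p x₀ := by
  by_cases hw : w0 p x₀ = 0
  · simp [hw]
  · rw [← faceInt_cube hn hx hw, ← mul_assoc]
    congr 1
    rcases lt_or_gt_of_ne hw with h | h
    · rw [Real.sign_of_neg h, abs_of_neg h]; ring
    · rw [Real.sign_of_pos h, abs_of_pos h]; ring

/-- Add the cases `d = e = u` and `d = e = v` of the auxiliary identity. Since the squared
tangential part is `r² - w0²`, the left side becomes the integral of `r⁻¹` plus `w0²` times that of
`r⁻³`. -/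
theorem faceInt_inv_norm
    (hn : cross (p 1 - p 0) (p 2 - p 0) ≠ 0) (hx : x₀ ∉ convexHull ℝ (range p)) :
    faceInt p (fun x => ‖x - x₀‖⁻¹) = ∑ i, t p x₀ i * f p x₀ i - |w0 p x₀| * β p x₀ := by
  have hu := faceInt_inner_mul_inner_aux hn hx (inner_w_u hn) (inner_w_u hn)
  have hv := faceInt_inner_mul_inner_aux (p := p) hn hx inner_w_v inner_w_v
  have hc1 : ContinuousOn (fun x => ‖x - x₀‖⁻¹) (convexHull ℝ (range p)) := by
    simpa using continuousOn_inv_norm_pow hx 1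
  have hc3 := continuousOn_inv_norm_pow hx 3
  have hs : faceInt p (fun x => ⟪u p, x - x₀⟫ * ⟪u p, x - x₀⟫ * (‖x - x₀‖ ^ 3)⁻¹)
      + faceInt p (fun x => ⟪v p, x - x₀⟫ * ⟪v p, x - x₀⟫ * (‖x - x₀‖ ^ 3)⁻¹)
      = faceInt p (fun x => ‖x - x₀‖⁻¹)
        + -w0 p x₀ ^ 2 * faceInt p (fun x => (‖x - x₀‖ ^ 3)⁻¹) := by
    rw [← faceInt_add, ← faceInt_const_mul, ← faceInt_add]
    · refine faceInt_congr fun x h => ?_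
      have h0 := norm_pos_of_mem hx h
      have hsq := inner_sq_add_inner_sq (x₀ := x₀) hn h
      field_simp
      linear_combination hsq
    all_goals fun_prop
  have hsum := congrArg₂ (· + ·) hu hv
  beta_reduce at hsum
  rw [← Finset.sum_add_distrib] at hsum
  -- Summing over `u` and `v` produces `⟪m, m⟫ = 1` and `⟪m, s⟫ = 0`, so the terms in `Rplus -
  -- Rminus` cancel.
  have hR : ∀ i, ⟪m p i, u p⟫ * (⟪u p, m p i⟫ * (t p x₀ i * f p x₀ i)
        + ⟪u p, s p i⟫ * (Rplus p x₀ i - Rminus p x₀ i))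
      + ⟪m p i, v p⟫ * (⟪v p, m p i⟫ * (t p x₀ i * f p x₀ i)
        + ⟪v p, s p i⟫ * (Rplus p x₀ i - Rminus p x₀ i)) = t p x₀ i * f p x₀ i := fun i => by
    have h1 := inner_uv hn (x := m p i) (y := m p i) (inner_w_m i)
    have h2 := inner_uv hn (x := m p i) (y := s p i) (inner_w_m i)
    rw [real_inner_self_eq_norm_sq, norm_m hn] at h1
    rw [real_inner_comm, inner_s_m] at h2
    linear_combination (-(t p x₀ i * f p x₀ i)) * h1 - (Rplus p x₀ i - Rminus p x₀ i) * h2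
  rw [Finset.sum_congr rfl fun i _ => hR i, real_inner_self_eq_norm_sq,
    real_inner_self_eq_norm_sq, norm_u hn, norm_v hn] at hsum
  linear_combination hsum + hs - sq_mul_faceInt_cube hn hx

theorem faceInt_inner_mul_inner
    (hn : cross (p 1 - p 0) (p 2 - p 0) ≠ 0) (hx : x₀ ∉ convexHull ℝ (range p))
    {d e : E3} (hd : ⟪w p, d⟫ = 0) (he : ⟪w p, e⟫ = 0) :
    faceInt p (fun x => ⟪e, x - x₀⟫ * ⟪d, x - x₀⟫ * (‖x - x₀‖ ^ 3)⁻¹) =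
      ∑ i, ⟪e, s p i⟫ * (f p x₀ i * t p x₀ i * ⟪s p i, d⟫
        - (Rplus p x₀ i - Rminus p x₀ i) * ⟪m p i, d⟫) - |w0 p x₀| * β p x₀ * ⟪e, d⟫ := by
  have h := faceInt_inner_mul_inner_aux hn hx hd he
  rw [faceInt_inv_norm hn hx] at h
  -- Expanding `⟪e, d⟫` in the frame of edge `i` cancels the `m`-part and leaves `⟪e, s⟫ ⟪s, d⟫`.
  have hi : ∀ i, ⟪e, s p i⟫ * (f p x₀ i * t p x₀ i * ⟪s p i, d⟫
        - (Rplus p x₀ i - Rminus p x₀ i) * ⟪m p i, d⟫) = ⟪e, d⟫ * (t p x₀ i * f p x₀ i)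
      - ⟪m p i, d⟫ * (⟪e, m p i⟫ * (t p x₀ i * f p x₀ i)
        + ⟪e, s p i⟫ * (Rplus p x₀ i - Rminus p x₀ i)) := fun i => by
    rw [inner_sm hn i (y := d) he]; ring
  rw [Finset.sum_congr rfl fun i _ => hi i, Finset.sum_sub_distrib, ← h, ← Finset.mul_sum]
  ring

/-- The common form of `Mu` and `Mv`. -/
noncomputable def firstMoment (p : Fin 3 → E3) (x₀ e : E3) : E3 :=
  ∑ i, ⟪e, s p i⟫ •
      ((f p x₀ i * t p x₀ i) • s p i - (Rplus p x₀ i - Rminus p x₀ i) • m p i)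
    - (|w0 p x₀| * β p x₀) • e
    - ((∑ i, ⟪e, m p i⟫ * f p x₀ i) * w0 p x₀) • w p

/-- The tangential part of `M` contributes the logarithms. Its normal part multiplies the constant
`w0` and contributes the solid angle term. -/
theorem faceInt_dipole
    (hn : cross (p 1 - p 0) (p 2 - p 0) ≠ 0) (hx : x₀ ∉ convexHull ℝ (range p)) (M : E3) :
    faceInt p (fun x => ⟪M, x - x₀⟫ * (‖x - x₀‖ ^ 3)⁻¹) = ⟪M0 p x₀, M⟫ := by
  have hc3 := continuousOn_inv_norm_pow hx 3
  set k := ⟪w p, M⟫ with hk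
  set d := M - k • w p with hd
  have hdw : ⟪w p, d⟫ = 0 := by
    rw [hd, inner_sub_right, inner_smul_right, real_inner_self_eq_norm_sq, norm_w hn, hk]; ring
  have hM : M = d + k • w p := by rw [hd]; abel
  have h1 : faceInt p (fun x => ⟪M, x - x₀⟫ * (‖x - x₀‖ ^ 3)⁻¹) =
      faceInt p (fun x => ⟪d, x - x₀⟫ * (‖x - x₀‖ ^ 3)⁻¹)
        + k * w0 p x₀ * faceInt p (fun x => (‖x - x₀‖ ^ 3)⁻¹) := by
    rw [← faceInt_const_mul, ← faceInt_add (by fun_prop) (by fun_prop)]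
    refine faceInt_congr fun x h => ?_
    conv_lhs => rw [hM, inner_add_left, real_inner_smul_left, inner_w_hull hn h]
    ring
  rw [h1, faceInt_inner_div_cube hn hx hdw, mul_assoc, mul_faceInt_cube hn hx, M0,
    inner_sub_left, real_inner_smul_left, sum_inner, ← hk]
  have h2 : ∀ i, ⟪f p x₀ i • m p i, M⟫ = ⟪m p i, d⟫ * f p x₀ i := fun i => by
    rw [real_inner_smul_left, hM, inner_add_right, inner_smul_right, real_inner_comm (w p),
      inner_w_m]
    ring
  rw [Finset.sum_congr rfl fun i _ => h2 i]
  ring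

theorem faceInt_inner_mul_dipole
    (hn : cross (p 1 - p 0) (p 2 - p 0) ≠ 0) (hx : x₀ ∉ convexHull ℝ (range p)) (M : E3)
    {e : E3} (he : ⟪w p, e⟫ = 0) :
    faceInt p (fun x => ⟪e, x - x₀⟫ * (⟪M, x - x₀⟫ * (‖x - x₀‖ ^ 3)⁻¹)) =
      ⟪firstMoment p x₀ e, M⟫ := by
  have hc3 := continuousOn_inv_norm_pow hx 3
  set k := ⟪w p, M⟫ with hk
  set d := M - k • w p with hd
  have hdw : ⟪w p, d⟫ = 0 := by
    rw [hd, inner_sub_right, inner_smul_right, real_inner_self_eq_norm_sq, norm_w hn, hk]; ring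
  have hM : M = d + k • w p := by rw [hd]; abel
  have h1 : faceInt p (fun x => ⟪e, x - x₀⟫ * (⟪M, x - x₀⟫ * (‖x - x₀‖ ^ 3)⁻¹)) =
      faceInt p (fun x => ⟪e, x - x₀⟫ * ⟪d, x - x₀⟫ * (‖x - x₀‖ ^ 3)⁻¹)
        + k * w0 p x₀ * faceInt p (fun x => ⟪e, x - x₀⟫ * (‖x - x₀‖ ^ 3)⁻¹) := by
    rw [← faceInt_const_mul, ← faceInt_add (by fun_prop) (by fun_prop)]
    refine faceInt_congr fun x h => ?_
    conv_lhs => rw [hM, inner_add_left, real_inner_smul_left, inner_w_hull hn h]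
    ring
  have hperp : ∀ y, ⟪w p, y⟫ = 0 → ⟪y, M⟫ = ⟪y, d⟫ := fun y hy => by
    rw [hM, inner_add_right, inner_smul_right, real_inner_comm (w p), hy]; ring
  have h2 : ∀ i, ⟪⟪e, s p i⟫ • ((f p x₀ i * t p x₀ i) • s p i
        - (Rplus p x₀ i - Rminus p x₀ i) • m p i), M⟫ =
      ⟪e, s p i⟫ * (f p x₀ i * t p x₀ i * ⟪s p i, d⟫
        - (Rplus p x₀ i - Rminus p x₀ i) * ⟪m p i, d⟫) := fun i => by
    rw [real_inner_smul_left, inner_sub_left, real_inner_smul_left, real_inner_smul_left,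
      hperp _ (inner_w_s hn i), hperp _ (inner_w_m i)]
  rw [h1, faceInt_inner_mul_inner hn hx hdw he, faceInt_inner_div_cube hn hx he, firstMoment,
    inner_sub_left, inner_sub_left, real_inner_smul_left, real_inner_smul_left, sum_inner,
    Finset.sum_congr rfl fun i _ => h2 i, hperp e he, ← hk,
    Finset.sum_congr rfl fun i _ => congrArg (· * f p x₀ i) (real_inner_comm e (m p i))]
  ring

/-- An affine function on a triangle in terms of its nodal values. -/
theorem affine_eq_on_hull (hn : cross (p 1 - p 0) (p 2 - p 0) ≠ 0) (g : E3 →ᵃ[ℝ] ℝ) {x : E3}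
    (hx : x ∈ convexHull ℝ (range p)) :
    g x = φ₀ p x₀ ⬝ᵥ (fun k => g (p k)) + (a p ⬝ᵥ fun k => g (p k)) * ⟪u p, x - x₀⟫
      + (b p ⬝ᵥ fun k => g (p k)) * ⟪v p, x - x₀⟫ := by
  have hsub : convexHull ℝ (range p) ⊆ {x | g x = φ₀ p x₀ ⬝ᵥ (fun k => g (p k))
      + (a p ⬝ᵥ fun k => g (p k)) * ⟪u p, x - x₀⟫
      + (b p ⬝ᵥ fun k => g (p k)) * ⟪v p, x - x₀⟫} := by
    refine convexHull_min ?_ fun x hx y hy a b _ _ hab => ?_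
    · rintro _ ⟨i, rfl⟩
      have hγ := (γ_pos hn 2).ne'
      have hv := (v3_pos hn).ne'
      rw [mem_ofPred_eq, inner_u_vertex hn, inner_v_vertex hn]
      simp only [φ₀, a, b, dotProduct, Fin.sum_univ_three, Pi.add_apply, Pi.smul_apply,
        Matrix.cons_val, smul_eq_mul]
      -- Both sides are affine, so agreement at the three vertices suffices.
      fin_cases i <;> simp <;> field_simp <;> ring
    · simp only [mem_ofPred_eq] at hx hy ⊢
      rw [Convex.combo_affine_apply hab, hx, hy]
      obtain rfl : b = 1 - a := by linarith
      simp only [inner_sub_right, inner_add_right, inner_smul_right, smul_eq_mul]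
      ring
  exact hsub hx

/-- The closed form of the dipole integral over a triangle. -/
theorem inner_I_eq_faceInt
    (hn : cross (p 1 - p 0) (p 2 - p 0) ≠ 0) (hx : x₀ ∉ convexHull ℝ (range p)) (M : E3)
    (g : E3 →ᵃ[ℝ] ℝ) {c : Fin 3 → ℝ} (hc : ∀ k, c k = g (p k)) :
    faceInt p (fun x => g x * (⟪M, x - x₀⟫ * (‖x - x₀‖ ^ 3)⁻¹)) = ⟪I p x₀ c, M⟫ := by
  obtain rfl : c = fun k => g (p k) := funext hc
  have hc3 := continuousOn_inv_norm_pow hx 3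
  have hI : I p x₀ (fun k => g (p k)) = (φ₀ p x₀ ⬝ᵥ fun k => g (p k)) • M0 p x₀
      + (a p ⬝ᵥ fun k => g (p k)) • firstMoment p x₀ (u p)
      + (b p ⬝ᵥ fun k => g (p k)) • firstMoment p x₀ (v p) := by
    ext k
    simp only [I, matVec, MMat, Matrix.mulVec, dotProduct, Fin.sum_univ_three, Matrix.of_apply,
      Matrix.cons_val, PiLp.add_apply, PiLp.smul_apply, smul_eq_mul]
    rw [show Mu p x₀ = firstMoment p x₀ (u p) from rfl,
      show Mv p x₀ = firstMoment p x₀ (v p) from rfl]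
    ring
  rw [hI, inner_add_left, inner_add_left, real_inner_smul_left, real_inner_smul_left,
    real_inner_smul_left, ← faceInt_dipole hn hx, ← faceInt_inner_mul_dipole hn hx M (inner_w_u hn),
    ← faceInt_inner_mul_dipole hn hx M inner_w_v, ← faceInt_const_mul, ← faceInt_const_mul,
    ← faceInt_const_mul, ← faceInt_add, ← faceInt_add]
  · refine faceInt_congr fun x h => ?_
    rw [affine_eq_on_hull (x₀ := x₀) hn g h]
    ring
  all_goals fun_prop

end Tri

end FaceFormulas

/-! ### Gradients of the nodal basis and reduction to interior points. -/

section Assembly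

open MeasureTheory Set

theorem hasFDerivAt_affineMap {F : Type*} [NormedAddCommGroup F] [NormedSpace ℝ F]
    (g : E3 →ᵃ[ℝ] F) (x : E3) :
    HasFDerivAt g (LinearMap.toContinuousLinearMap g.linear) x := by
  have h := ((LinearMap.toContinuousLinearMap g.linear).hasFDerivAt (x := x)).add_const (g 0)
  convert! h using 1
  exact AffineMap.decomp g

theorem contDiff_affineMap (g : E3 →ᵃ[ℝ] ℝ) : ContDiff ℝ 1 g := by
  have h := (LinearMap.toContinuousLinearMap g.linear).contDiff (n := 1).add
    (contDiff_const (c := g 0))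
  convert! h using 1
  exact AffineMap.decomp g

/-- If `x × y = 0`, the expansion of `(x × y) × x` is a linear relation between `x` and `y` in which
`y` has coefficient `‖x‖²`. Independence then forces `x = 0`, a contradiction. -/
theorem cross_ne_zero {p : Fin 3 → E3} (hp : AffineIndependent ℝ p) :
    cross (p 1 - p 0) (p 2 - p 0) ≠ 0 := by
  intro h
  rw [affineIndependent_iff_linearIndependent_vsub ℝ _ 0] at hp
  have hp' := hp.comp (fun k : Fin 2 => (⟨k.succ, Fin.succ_ne_zero k⟩ : {i : Fin 3 // i ≠ 0}))
    fun k l hkl => Fin.succ_injective _ (congrArg Subtype.val hkl)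
  have he : ((fun i : {i : Fin 3 // i ≠ 0} => p i -ᵥ p 0) ∘
      fun k : Fin 2 => ⟨k.succ, Fin.succ_ne_zero k⟩) = ![p 1 - p 0, p 2 - p 0] := by
    ext1 k
    fin_cases k <;> rfl
  have hl : LinearIndependent ℝ ![p 1 - p 0, p 2 - p 0] := he ▸ hp'
  rw [LinearIndependent.pair_iff] at hl
  have h0 := cross_cross_left (p 1 - p 0) (p 2 - p 0) (p 1 - p 0)
  have hz : cross 0 (p 1 - p 0) = 0 := by simpa using cross_smul_left 0 0 (p 1 - p 0)
  rw [h, hz] at h0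
  have h1 := (hl (-⟪p 2 - p 0, p 1 - p 0⟫) ⟪p 1 - p 0, p 1 - p 0⟫
    (by rw [h0]; module)).2
  rw [inner_self_eq_zero] at h1
  have := (hl 1 0 (by simp [h1])).1
  exact one_ne_zero this

theorem inner_matVec_comm {S : Matrix (Fin 3) (Fin 3) ℝ} (hS : S.IsSymm) (x y : E3) :
    ⟪matVec S x, y⟫ = ⟪x, matVec S y⟫ := by
  have h01 := hS.apply 0 1
  have h02 := hS.apply 0 2
  have h12 := hS.apply 1 2
  simp only [inner_E3, matVec, Matrix.mulVec, dotProduct, Fin.sum_univ_three]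
  rw [h01, h02, h12]
  ring

/-- The right side is the difference of nodal values at the two ends of the edge from `0` to `e_k`,
the form in which `gradient_nodal` meets it on `K`. -/
theorem fderiv_shapeFun (i : Fin 4) (k : Fin 3) :
    fderiv ℝ (shapeFun i) 0 (EuclideanSpace.single k 1) =
      (if i = k.succ then 1 else 0) - if i = 0 then 1 else 0 := by
  have hp : ∀ l : Fin 3, HasFDerivAt (fun x : E3 => x l) (EuclideanSpace.proj l : E3 →L[ℝ] ℝ) 0 :=
    fun l => (EuclideanSpace.proj l : E3 →L[ℝ] ℝ).hasFDerivAt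
  have hk : ∀ l : Fin 3, fderiv ℝ (fun x : E3 => x l) 0 (EuclideanSpace.single k 1)
      = if l = k then 1 else 0 := fun l => by
    rw [(hp l).fderiv]; simp
  fin_cases i
  · have h0 : HasFDerivAt (shapeFun 0) _ 0 := (((hp 0).const_sub 1).sub (hp 1)).sub (hp 2)
    simp only [Fin.zero_eta]
    rw [h0.fderiv]
    fin_cases k <;> simp
  · refine (hk 0).trans ?_
    fin_cases k <;> simp
  · refine (hk 1).trans ?_
    fin_cases k <;> simp
  · refine (hk 2).trans ?_
    fin_cases k <;> simp

theorem shapeGrad_apply (k : Fin 3) (i : Fin 4) :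
    shapeGrad k i = (if i = k.succ then 1 else 0) - if i = 0 then 1 else 0 := by
  rw [← fderiv_shapeFun, ← inner_gradient_left, EuclideanSpace.inner_single_right]
  simp [shapeGrad]

theorem affineJacobian_apply {P : Fin 4 → E3} {μ : E3 →ᵃ[ℝ] E3}
    (hμ : ∀ i, μ (refVertex i) = P i) (k l : Fin 3) :
    affineJacobian μ k l = (P l.succ - P 0) k := by
  have h : μ.linear (EuclideanSpace.single l 1) = P l.succ - P 0 := by
    rw [← hμ, ← hμ, ← vsub_eq_sub, ← AffineMap.linearMap_vsub]
    fin_cases l <;> simp [refVertex]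
  rw [affineJacobian, Matrix.of_apply, (hasFDerivAt_affineMap μ 0).fderiv,
    LinearMap.coe_toContinuousLinearMap', h]

theorem isUnit_affineJacobian {P : Fin 4 → E3} (hP : AffineIndependent ℝ P) {μ : E3 →ᵃ[ℝ] E3}
    (hμ : ∀ i, μ (refVertex i) = P i) : IsUnit (affineJacobian μ) := by
  rw [← Matrix.mulVec_injective_iff_isUnit]
  intro x y hxy
  have : WithLp.toLp 2 x = (WithLp.toLp 2 y : E3) := columnMap_injective hP (by
    ext k
    have := congrFun hxy k
    simp only [Matrix.mulVec, dotProduct, affineJacobian_apply hμ, Fin.sum_univ_three,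
      Fin.succ_zero_eq_one, Fin.succ_one_eq_two, show (2 : Fin 3).succ = 3 from rfl] at this
    simp only [columnMap_apply, PiLp.add_apply, PiLp.smul_apply, smul_eq_mul]
    linear_combination this)
  simpa using this

/-- The gradients of the nodal basis functions. -/
theorem gradient_nodal {P : Fin 4 → E3} (hP : AffineIndependent ℝ P) {μ : E3 →ᵃ[ℝ] E3}
    (hμ : ∀ i, μ (refVertex i) = P i) {i : Fin 4} {g : E3 →ᵃ[ℝ] ℝ}
    (hg : ∀ j, g (P j) = if i = j then 1 else 0) (x : E3) :
    ∇ g x = WithLp.toLp 2 (((affineJacobian μ)⁻¹.transpose * shapeGrad).col i) := by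
  set A := affineJacobian μ
  have hA : IsUnit A.transpose.det := by
    rw [Matrix.det_transpose]
    exact (Matrix.isUnit_iff_isUnit_det _).1 (isUnit_affineJacobian hP hμ)
  -- The columns of `A` are the edges at `P 0`, and pairing `∇ g` with an edge gives the difference
  -- of the nodal values at its ends.
  have h : A.transpose.mulVec (∇ g x).ofLp = shapeGrad.col i := by
    ext l
    have h1 : ⟪∇ g x, P l.succ - P 0⟫ = shapeGrad l i := by
      rw [inner_gradient_left, (hasFDerivAt_affineMap g x).fderiv,
        LinearMap.coe_toContinuousLinearMap', ← vsub_eq_sub, AffineMap.linearMap_vsub, hg, hg,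
        shapeGrad_apply]
      rfl
    rw [Matrix.col_apply, ← h1, inner_E3]
    simp only [Matrix.mulVec, dotProduct, Matrix.transpose_apply, A, affineJacobian_apply hμ,
      Fin.sum_univ_three]
    ring
  have h2 : (∇ g x).ofLp = (A⁻¹.transpose * shapeGrad).col i := by
    have : (A⁻¹.transpose * shapeGrad).col i = A⁻¹.transpose.mulVec (shapeGrad.col i) := by
      ext k; simp [Matrix.mul_apply, Matrix.mulVec, dotProduct]
    rw [this, ← h, Matrix.mulVec_mulVec, Matrix.transpose_nonsing_inv,
      Matrix.nonsing_inv_mul _ hA, Matrix.one_mulVec]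
  rw [← h2]

/-- The frontier of a convex set is a null set. -/
theorem ae_mem_interior_of_mem_tetrahedron (P : Fin 4 → E3) :
    ∀ᵐ x, x ∈ tetrahedron P → x ∈ interior (tetrahedron P) := by
  have h := (convex_convexHull ℝ (range P)).addHaar_frontier volume
  filter_upwards [measure_eq_zero_iff_ae_notMem.1 h] with x hx hxK
  by_contra hi
  exact hx ⟨subset_closure hxK, hi⟩

theorem eventuallyEq_of_eqOn_interior {f g : E3 → ℝ} {S : Set E3} (h : EqOn f g S) {x : E3}
    (hx : x ∈ interior S) : f =ᶠ[nhds x] g :=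
  Filter.mem_of_superset (mem_interior_iff_mem_nhds.1 hx) h

end Assembly

theorem lemmaD1
    -- the tetrahedron `K` with vertices `P`, the source, and the conductivities
    (P : Fin 4 → E3) (hP : AffineIndependent ℝ P)
    (x₀ M : E3) (hx₀ : x₀ ∉ tetrahedron P)
    (σ : Matrix (Fin 3) (Fin 3) ℝ) (hσ : σ.IsSymm) (σinf : ℝ) (hσinf : 0 < σinf)
    -- the cutoff function and the nodal basis functions
    (χ : E3 → ℝ) (hχ : IsAffineOn χ (tetrahedron P))
    (φ : Fin 4 → E3 → ℝ) (hφ : IsNodalBasis P φ)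
    -- the affine map from the reference tetrahedron onto `K`
    (μ : E3 →ᵃ[ℝ] E3) (hμ : ∀ i, μ (refVertex i) = P i)
    -- the face `j` lies opposite to `P j`; `ν j` is an arbitrary numbering of its vertices
    (ν : (j : Fin 4) → Fin 3 ≃ {i : Fin 4 // i ≠ j})
    (p : Fin 4 → Fin 3 → E3) (hp : ∀ j k, p j k = P (ν j k))
    (η : Fin 4 → E3)
    (hη : ∀ j, IsUnitOuterNormal (tetrahedron P) (convexHull ℝ (Set.range (p j))) (η j)) :
    (∀ i, MeasureTheory.IntegrableOn
      (fun x => ⟪matVec σ (∇ (fun y => χ y * uInf σinf x₀ M y) x), ∇ (φ i) x⟫)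
      (tetrahedron P)) ∧
    (fun i => ∫ x in tetrahedron P,
        ⟪matVec σ (∇ (fun y => χ y * uInf σinf x₀ M y) x), ∇ (φ i) x⟫) =
      ((1 / (4 * Real.pi * σinf)) •
          (σ * (affineJacobian μ)⁻¹.transpose * shapeGrad).transpose).mulVec
        (∑ j, ⟪Tri.I (p j) x₀ (fun k => χ (p j k)), M⟫ • η j).ofLp := by
  obtain ⟨g, hg⟩ := hχ
  choose α hα using fun i => (hφ i).1
  have hPK : ∀ i, P i ∈ tetrahedron P := fun i => subset_convexHull ℝ _ (Set.mem_range_self i)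
  set C : ℝ := 1 / (4 * Real.pi * σinf) with hC
  set G : E3 → ℝ := fun x => g x * (⟪M, x - x₀⟫ * (‖x - x₀‖ ^ 3)⁻¹) with hG
  set n : Fin 4 → E3 := fun i =>
    WithLp.toLp 2 (((affineJacobian μ)⁻¹.transpose * shapeGrad).col i) with hn
  have hne : ∀ x ∈ tetrahedron P, x ≠ x₀ := fun x h he => hx₀ (he ▸ h)
  have hGs : ∀ x ∈ tetrahedron P, ContDiffAt ℝ 1 G x := fun x h => by
    refine (contDiff_affineMap g).contDiffAt.mul
      (contDiffAt_inner_mul_radial (k := fun r => (r ^ 3)⁻¹) (hne x h) ?_ M)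
    exact (contDiffAt_id.pow 3).inv
      (pow_ne_zero 3 (norm_ne_zero_iff.2 (sub_ne_zero.2 (hne x h))))
  have hEq : Set.EqOn (fun y => χ y * uInf σinf x₀ M y) (fun y => C * G y) (tetrahedron P) :=
    fun x h => by
      simp only [hG, hC, hg h, uInf]
      ring
  -- `χ` and `φ i` are prescribed only on `K`, while a gradient depends on a full neighbourhood. The
  -- integrand is thus known at interior points only, which is enough almost everywhere.
  have hint : ∀ i, ∀ x ∈ interior (tetrahedron P),
      ⟪matVec σ (∇ (fun y => χ y * uInf σinf x₀ M y) x), ∇ (φ i) x⟫ =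
        C * fderiv ℝ G x (matVec σ (n i)) := fun i x h => by
    have h1 : ∇ (φ i) x = n i := by
      rw [gradient, (eventuallyEq_of_eqOn_interior (hα i) h).fderiv_eq, ← gradient,
        gradient_nodal hP hμ fun j => (hα i (hPK j)).symm.trans ((hφ i).2 j)]
    rw [h1, inner_matVec_comm hσ, inner_gradient_left,
      (eventuallyEq_of_eqOn_interior hEq h).fderiv_eq,
      fderiv_const_mul ((hGs x (interior_subset h)).differentiableAt one_ne_zero)]
    rfl
  have hae : ∀ i, ∀ᵐ x, x ∈ tetrahedron P →
      ⟪matVec σ (∇ (fun y => χ y * uInf σinf x₀ M y) x), ∇ (φ i) x⟫ =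
        C * fderiv ℝ G x (matVec σ (n i)) := fun i => by
    filter_upwards [ae_mem_interior_of_mem_tetrahedron P] with x hx hxK
    exact hint i x (hx hxK)
  have hKm : MeasurableSet (tetrahedron P) := (isCompact_tetrahedron P).isClosed.measurableSet
  have hcont : ∀ i, ContinuousOn (fun x => C * fderiv ℝ G x (matVec σ (n i))) (tetrahedron P) :=
    fun i => continuousOn_const.mul (continuousOn_fderiv_apply hGs _)
  refine ⟨fun i => ((hcont i).integrableOn_compact (isCompact_tetrahedron P)).congr_fun_ae
    (((MeasureTheory.ae_restrict_iff' hKm).2 (hae i)).mono fun x hx => hx.symm), ?_⟩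
  have hface : ∀ j, faceInt (p j) G = ⟪Tri.I (p j) x₀ (fun k => χ (p j k)), M⟫ := fun j => by
    have hpj : p j = P ∘ ((ν j).toEmbedding.trans (Function.Embedding.subtype _)) :=
      funext fun k => hp j k
    have hsub : Set.range (p j) ⊆ Set.range P := by
      rw [hpj]; exact Set.range_comp_subset_range _ _
    exact Tri.inner_I_eq_faceInt (cross_ne_zero (hpj ▸ hP.comp_embedding _))
      (fun h => hx₀ (convexHull_mono hsub h)) M g fun k => hp j k ▸ hg (hPK _)
  ext i
  rw [MeasureTheory.setIntegral_congr_ae hKm (hae i), MeasureTheory.integral_const_mul,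
    setIntegral_fderiv_tetrahedron hP hp hη hGs, Matrix.smul_mulVec, Pi.smul_apply, smul_eq_mul]
  congr 1
  have hcol : matVec σ (n i) =
      WithLp.toLp 2 ((σ * (affineJacobian μ)⁻¹.transpose * shapeGrad).col i) := by
    ext k
    rw [Matrix.mul_assoc]
    simp [matVec, hn, Matrix.mul_apply, Matrix.mulVec, dotProduct]
  -- Row `i` of the transposed matrix is `σ ∇φ_i`, so the matrix product pairs the sum of normals
  -- with the direction used in the gradient theorem.
  have hrow : ∀ y : E3, (σ * (affineJacobian μ)⁻¹.transpose * shapeGrad).transpose.mulVec y.ofLp i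
      = ⟪matVec σ (n i), y⟫ := fun y => by
    rw [hcol, inner_E3]
    simp only [Matrix.mulVec, dotProduct, Matrix.transpose_apply, Fin.sum_univ_three,
      Matrix.col_apply]
  rw [hrow, inner_sum]
  refine Finset.sum_congr rfl fun j _ => ?_
  rw [hface, inner_smul_right, real_inner_comm]
  ring
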